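/- Let $\varphi(s)=s-1-\ln s$ (principal branch of the logarithm). Let $L=\{z\ne 0:\ \operatorname{Re}\varphi(z)=0\}$, and let $\Sigma=\{z\neq 0:\ \operatorname{Im}\varphi(z)=0,\ \operatorname{Re}\varphi(z)\le 0\}$ be the path of steepest descent through the critical point $1$ of $\varphi$. A contour $\gamma$ is called admissible if it is a smooth Jordan curve winding once counterclockwise around the origin, and there is an open neighbourhood $U$ of $1$ such that $\gamma\cap U=\Sigma\cap U$ and $\gamma\setminus U$ has positive distance from $L$. For $n\ge 1$ and $z\notin\gamma$ put $$F_n(z)=\frac1{2\pi i}\int_\gamma\frac{s^{-n}e^{n(s-1)}}{s-z}\,ds .$$ There is a biholomorphic map $\lambda$ from a disc $U_{\delta_0}(0)$ onto an open neighbourhood $U_0$ of $1$ with $\lambda(0)=1$, $\lambda'(0)=\sqrt2$ and $\varphi(\lambda(\xi))=\xi^2$. Fix any such $\lambda$, and define $$h(\zeta)=\frac1{2\pi i}\int_{\mathbb R}\frac{e^{-u^2}}{u-\zeta}\,du\quad(\zeta\in\mathbb C\setminus\mathbb R),\qquad P_n(z)=h\bigl(-i\sqrt n\,\lambda^{-1}(z)\bigr)\quad(z\in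 U_0\setminus\Sigma).$$ **Theorem.** There exist $\varepsilon>0$ with $U_\varepsilon(1)\subseteq U_0$ and functions $g_j$ ($j\ge 0$), analytic in $U_\varepsilon(1)$, such that for every admissible contour $\gamma$ and every $r\in\mathbb N$ we have, for $n\ge1$, $$F_n(z)=P_n(z)+\frac1{\sqrt{2\pi n}}\left(\sum_{j=0}^{r-1}\frac{g_j(z)}{n^j}+O\!\left(\frac1{n^r}\right)\right),$$ uniformly for all $z\in U_\varepsilon(1)\setminus\gamma$ at which $P_n(z)$ is defined, that is, for $z\in U_\varepsilon(1)\setminus(\gamma\cup\Sigma)$; the constant in the error term may depend on $\gamma$ and $r$ only. (If $\gamma$ coincides with $\Sigma$ in $U_\varepsilon(1)$, this set is $U_\varepsilon(1)\setminus\gamma$.) The Taylor coefficients of all $g_j$ at $1$ are explicitly computable from those of $\lambda^{-1}$: for each $j$ there is a polynomial $q_j$ of degree at most $2j$ such that $$g_j(z)=\frac{(-1)^j\,\Gamma(j+\frac12)}{\sqrt{2\pi}\,\bigl(\lambda^{-1}(z)\bigr)^{2j+1}}-\frac{q_j(z-1)}{(z-1)^{2j+1}}\qquad(z\in U_\varepsilon(1),\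 z\ne1),$$ that is, $g_j$ is the regular part of the Laurent expansion at $1$ of the first term on the right. In particular, $$g_0(z)=\frac13-\frac1{12}(z-1)+O\bigl((z-1)^2\bigr)\qquad(z\to1).$$ -/

import Mathlib

open scoped Real Topology

namespace SzegoCauchy

noncomputable section

/-- The phase function `φ(s) = s - 1 - ln s`, with the principal branch of the logarithm. -/
def phi (s : ℂ) : ℂ := s - 1 - Complex.log s

/-- The level curve `Re φ = Re φ(1) = 0` through the critical point `1` of `φ`. -/
def levelCurve : Set ℂ := {z | z ≠ 0 ∧ (phi z).re = 0}

/-- The path of steepest descent from the critical point `1`: `Im φ = Im φ(1) = 0`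
(that is, `arg z = Im z`) and `Re φ ≤ Re φ(1) = 0`.  The second condition removes the ray of
steepest ascent, the positive real axis without the point `1`. -/
def descentPath : Set ℂ := {z | z ≠ 0 ∧ (phi z).im = 0 ∧ (phi z).re ≤ 0}

/-- A smooth Jordan curve, given by a regular `C¹` parametrization `γ : ℝ → ℂ` of period `1`
that is injective on a period. -/
structure IsSmoothJordanCurve (γ : ℝ → ℂ) : Prop where
  contDiff : ContDiff ℝ 1 γ
  deriv_ne_zero : ∀ t, deriv γ t ≠ 0
  periodic : Function.Periodic γ 1
  injOn : Set.InjOn γ (Set.Ico 0 1)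

/-- The contour integral `∫_γ f(s) ds` over one period of the parametrization. -/
def contourIntegral (γ : ℝ → ℂ) (f : ℂ → ℂ) : ℂ :=
  ∫ t in (0 : ℝ)..1, f (γ t) * deriv γ t

/-- `γ` winds around the origin once, counterclockwise. -/
def WindsCounterclockwise (γ : ℝ → ℂ) : Prop :=
  0 ∉ Set.range γ ∧ (2 * π * Complex.I)⁻¹ * contourIntegral γ (fun s => s⁻¹) = 1

/-- Admissible contours: smooth Jordan curves winding counterclockwise around the origin which
coincide with the path of steepest descent in some neighbourhood `U` of `1` and which,
outside `U`, have positive distance from the level curve `Re φ = 0`. -/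
structure IsAdmissible (γ : ℝ → ℂ) : Prop where
  smoothJordan : IsSmoothJordanCurve γ
  winds : WindsCounterclockwise γ
  near_one : ∃ U : Set ℂ, IsOpen U ∧ 1 ∈ U ∧
    Set.range γ ∩ U = descentPath ∩ U ∧
    ∃ d : ℝ, 0 < d ∧ ∀ s ∈ Set.range γ \ U, ∀ w ∈ levelCurve, d ≤ dist s w

/-- `F_n(z) = (2πi)⁻¹ ∫_γ s⁻ⁿ e^{n(s-1)} / (s - z) ds`. -/
def F (γ : ℝ → ℂ) (n : ℕ) (z : ℂ) : ℂ :=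
  (2 * π * Complex.I)⁻¹ *
    contourIntegral γ (fun s => (s ^ n)⁻¹ * Complex.exp (n * (s - 1)) / (s - z))

/-- `lam` is a biholomorphic map from the disc of radius `δ₀` about `0` onto an open
neighbourhood `lam.target` of `1`, with `φ (lam ξ) = ξ ^ 2`.  Of the two such maps
`ξ ↦ lam ξ` and `ξ ↦ lam (-ξ)` it is the one with `lam' 0 = √2`. -/
structure IsNormalForm (lam : OpenPartialHomeomorph ℂ ℂ) (δ₀ : ℝ) : Prop where
  pos : 0 < δ₀
  source_eq : lam.source = Metric.ball 0 δ₀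
  holo : DifferentiableOn ℂ lam lam.source
  holo_symm : DifferentiableOn ℂ lam.symm lam.target
  map_zero : lam 0 = 1
  deriv_zero : deriv lam 0 = (√2 : ℝ)
  phi_eq : ∀ ξ ∈ Metric.ball (0 : ℂ) δ₀, phi (lam ξ) = ξ ^ 2

/-- The Cauchy transform `h(ζ) = (2πi)⁻¹ ∫_ℝ e^{-u²} / (u - ζ) du` of the Gaussian,
meaningful for `ζ ∉ ℝ`. -/
def h (ζ : ℂ) : ℂ :=
  (2 * π * Complex.I)⁻¹ * ∫ u : ℝ, Complex.exp (-(u : ℂ) ^ 2) / ((u : ℂ) - ζ)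

/-- The parametrix `P_n(z) = h(-i √n λ⁻¹(z))`, meaningful for `z` in the range of `λ` and
not on the path of steepest descent (there `-i √n λ⁻¹(z)` is real). -/
def P (lam : OpenPartialHomeomorph ℂ ℂ) (n : ℕ) (z : ℂ) : ℂ :=
  h (-Complex.I * (√(n : ℝ) : ℝ) * lam.symm z)

end

end SzegoCauchy

/-! On the steepest descent path, written as s = λ(iu), the weight s⁻ⁿe^{n(s-1)} = e^{nφ(s)} is the
Gaussian e^{-nu²}. With z = λ(ξ) the Cauchy kernel becomes iλ'(iu)/(λ(iu) - λ(ξ)), whose pole iu = ξ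
may come arbitrarily close to the path, so Laplace's method does not apply uniformly in z. But 1/(u
+ iξ) has the same pole with the same residue, and its integral against e^{-nu²} over ℝ is exactly
2πi P_n(z) (`P_eq_integral`). The difference of the two kernels is i times `regKernel` at iu, which
is holomorphic in a fixed disc and bounded uniformly in ξ. Laplace's method for it gives the
expansion with a uniform error (`exists_norm_localIntegral_sub_le`).

Up to constants the g_j are the even Taylor coefficients of `regKernel` at 0. Geometric expansion
(`taylorCoeff_regKernel`) writes them as ξ^{-2j-1} minus a polynomial in 1/(z - 1), and the uniform
bound makes the singularity at z = 1 removable.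

The rest of the contour lies in the valley Re φ < 0, where the weight is exponentially small, but z
may be arbitrarily near it. `exists_norm_cauchyIntegral_le` handles this by subtracting the value of
the density at z. What remains is ∫ γ'/(γ - z): its real part depends only on the distances from z
to the endpoints, and its imaginary part is bounded independently of z. Since z may also be near an
endpoint, the contour is cut in two different ways (`exists_norm_contourIntegral_sub_le`).
Admissibility keeps the contour in the valley (`IsAdmissible.phi_re_neg`), and the winding number
makes it run upwards through 1 (`IsAdmissible.not_clockwise`), which fixes the sign of P_n. -/

namespace SzegoCauchy

/-! ### Taylor estimates and the regularized Cauchy kernel -/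

/-- The `k`-th Taylor coefficient of `f` at `0`. -/
noncomputable def taylorCoeff (f : ℂ → ℂ) (k : ℕ) : ℂ := iteratedDeriv k f 0 / (k.factorial : ℂ)

theorem norm_taylorCoeff_le {f : ℂ → ℂ} {δ R M : ℝ} (hR : 0 < R) (hRδ : R < δ)
    (hf : DifferentiableOn ℂ f (Metric.ball 0 δ))
    (hM : ∀ s ∈ Metric.sphere (0 : ℂ) R, ‖f s‖ ≤ M) (k : ℕ) :
    ‖taylorCoeff f k‖ ≤ M / R ^ k := by
  have hd : DiffContOnCl ℂ f (Metric.ball 0 R) := by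
    refine DifferentiableOn.diffContOnCl (hf.mono ?_)
    rw [closure_ball _ hR.ne']
    exact Metric.closedBall_subset_ball hRδ
  have := Complex.norm_iteratedDeriv_le_of_forall_mem_sphere_norm_le k hR hd hM
  have hk : (0 : ℝ) < k.factorial := by exact_mod_cast k.factorial_pos
  rw [taylorCoeff, norm_div, Complex.norm_natCast, div_le_iff₀ hk]
  calc _ ≤ _ := this
    _ = _ := by ring

/-- Cauchy's estimates and ‖w‖ ≤ R/2 dominate the tail of the series by a geometric series of ratio
1/2, whose sum is the factor 2. -/
theorem norm_sub_taylor_le {f : ℂ → ℂ} {δ R M : ℝ} (hR : 0 < R) (hRδ : R < δ)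
    (hf : DifferentiableOn ℂ f (Metric.ball 0 δ))
    (hM : ∀ s ∈ Metric.sphere (0 : ℂ) R, ‖f s‖ ≤ M) (m : ℕ) {w : ℂ} (hw : ‖w‖ ≤ R / 2) :
    ‖f w - ∑ k ∈ Finset.range m, taylorCoeff f k * w ^ k‖ ≤ 2 * M / R ^ m * ‖w‖ ^ m := by
  have hwb : w ∈ Metric.ball (0 : ℂ) δ := by
    rw [mem_ball_zero_iff]; linarith
  have hs : HasSum (fun k => taylorCoeff f k * w ^ k) (f w) := by
    have := Complex.hasSum_taylorSeries_on_ball hf hwb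
    have e : (fun k => taylorCoeff f k * w ^ k) =
        fun n : ℕ => (n.factorial : ℂ)⁻¹ • (w - 0) ^ n • iteratedDeriv n f 0 := by
      funext k
      simp only [taylorCoeff, sub_zero, smul_eq_mul]
      ring
    rwa [e]
  have hs' := (hasSum_nat_add_iff' m).2 hs
  have hg : HasSum (fun k : ℕ => M / R ^ m * ‖w‖ ^ m * (1 / 2 : ℝ) ^ k)
      (M / R ^ m * ‖w‖ ^ m * 2) := (hasSum_geometric_two).mul_left _
  have hM0 : 0 ≤ M := by
    have := hM (R : ℂ) (by simp [abs_of_pos hR])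
    exact (norm_nonneg _).trans this
  have := hs'.norm_le_of_bounded hg (fun k => ?_)
  · calc _ ≤ _ := this
      _ = _ := by ring
  · rw [norm_mul, norm_pow]
    calc ‖taylorCoeff f (k + m)‖ * ‖w‖ ^ (k + m)
        ≤ M / R ^ (k + m) * (‖w‖ ^ m * (R / 2) ^ k) := by
          rw [pow_add, mul_comm (‖w‖ ^ k)]
          gcongr
          exact norm_taylorCoeff_le hR hRδ hf hM _
      _ = _ := by
          rw [pow_add, div_pow, div_pow, one_pow]
          field_simp

/-- The kernel `f'(s) / (f s - f ξ) - 1 / (s - ξ)`, with its singularity at `ξ` removed. -/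
noncomputable def regKernel (f : ℂ → ℂ) (ξ s : ℂ) : ℂ :=
  dslope (fun s => deriv f s - dslope f ξ s) ξ s / dslope f ξ s

theorem regKernel_of_ne {f : ℂ → ℂ} {ξ s : ℂ} (hs : s ≠ ξ) (hf : f s ≠ f ξ) :
    regKernel f ξ s = deriv f s / (f s - f ξ) - 1 / (s - ξ) := by
  have h1 : s - ξ ≠ 0 := sub_ne_zero.2 hs
  have h2 : f s - f ξ ≠ 0 := sub_ne_zero.2 hf
  rw [regKernel, dslope_of_ne _ hs, dslope_of_ne _ hs, slope_def_field, slope_def_field]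
  simp only [dslope_same, dslope_of_ne _ hs, slope_def_field]
  field_simp
  ring

/-- The numerator is a divided difference, hence holomorphic. The denominator is (f s - f ξ)/(s -
ξ), nonzero by injectivity for s ≠ ξ and equal to f'(ξ) ≠ 0 at s = ξ. -/
theorem differentiableOn_regKernel {f : ℂ → ℂ} {U : Set ℂ} (hU : IsOpen U)
    (hf : DifferentiableOn ℂ f U) (hinj : Set.InjOn f U) (hd : ∀ s ∈ U, deriv f s ≠ 0)
    {ξ : ℂ} (hξ : ξ ∈ U) : DifferentiableOn ℂ (regKernel f ξ) U := by
  have hn := hU.mem_nhds hξ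
  have h1 : DifferentiableOn ℂ (dslope f ξ) U := (Complex.differentiableOn_dslope hn).2 hf
  have h2 : DifferentiableOn ℂ (fun s => deriv f s - dslope f ξ s) U := (hf.deriv hU).sub h1
  refine ((Complex.differentiableOn_dslope hn).2 h2).div h1 fun s hs => ?_
  by_cases h : s = ξ
  · rw [h, dslope_same]; exact hd ξ hξ
  · rw [dslope_of_ne _ h, slope_def_field]
    exact div_ne_zero (sub_ne_zero.2 fun e => h (hinj hs hξ e)) (sub_ne_zero.2 h)

theorem taylorCoeff_pow_mul {A : ℂ → ℂ} (hA : AnalyticAt ℂ A 0) (k : ℕ) :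
    taylorCoeff (fun s => s ^ (k + 1) * A s) k = 0 := by
  rw [taylorCoeff, div_eq_zero_iff]
  left
  have := iteratedDeriv_mul (n := k) (x := (0 : ℂ)) (f := fun s : ℂ => s ^ (k + 1)) (g := A)
    (by fun_prop) (hA.contDiffAt)
  refine Eq.trans this (Finset.sum_eq_zero fun i hi => ?_)
  rw [iteratedDeriv_fun_pow_zero, if_neg]
  · simp
  · have := Finset.mem_range.1 hi; omega

/-- Both 1/(s - ξ) and 1/(f s - f ξ) are expanded as finite geometric sums, in powers of s and of f
s - f 0. Since f s - f 0 is divisible by s, the remainders after k + 1 terms are divisible by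
s^(k+1) and do not reach the k-th coefficient. The finite sum on the right is the source of the
polynomials q_j. -/
theorem taylorCoeff_regKernel {f : ℂ → ℂ} {U : Set ℂ} (hU : IsOpen U)
    (hf : DifferentiableOn ℂ f U) (hinj : Set.InjOn f U) (h0 : 0 ∈ U)
    {ξ : ℂ} (hξ : ξ ∈ U) (hξ0 : ξ ≠ 0) (k : ℕ) :
    taylorCoeff (regKernel f ξ) k = 1 / ξ ^ (k + 1) -
      ∑ m ∈ Finset.range (k + 1),
        taylorCoeff (fun s => deriv f s * (f s - f 0) ^ m) k / (f ξ - f 0) ^ (m + 1) := by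
  have hv : f ξ - f 0 ≠ 0 := sub_ne_zero.2 fun e => hξ0 (hinj hξ h0 e)
  have hfa : AnalyticAt ℂ f 0 := hf.analyticAt (hU.mem_nhds h0)
  have hDa : AnalyticAt ℂ (dslope f 0) 0 :=
    ((Complex.differentiableOn_dslope (hU.mem_nhds h0)).2 hf).analyticAt (hU.mem_nhds h0)
  -- The two geometric remainders with the factor s^(k+1) split off; `dslope f 0 s` stands for (f s
  -- - f 0)/s.
  set A : ℂ → ℂ := fun s => -1 / (ξ ^ (k + 1) * (s - ξ)) +
    deriv f s * (dslope f 0 s) ^ (k + 1) / ((f ξ - f 0) ^ (k + 1) * (f s - f ξ)) with hAdef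
  have hA : AnalyticAt ℂ A 0 := by
    have hda := hfa.deriv
    have e1 : ξ ^ (k + 1) * (0 - ξ) ≠ 0 := by simp [hξ0]
    have e2 : (f ξ - f 0) ^ (k + 1) * (f 0 - f ξ) ≠ 0 :=
      mul_ne_zero (pow_ne_zero _ hv) (by rw [← neg_sub]; exact neg_ne_zero.2 hv)
    refine AnalyticAt.add (AnalyticAt.div (by fun_prop) (by fun_prop) e1)
      (AnalyticAt.div (by fun_prop) (by fun_prop) e2)
  have hev : regKernel f ξ =ᶠ[𝓝 0] fun s =>
      (∑ m ∈ Finset.range (k + 1), (1 / ξ ^ (m + 1) * s ^ m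
        - 1 / (f ξ - f 0) ^ (m + 1) * (deriv f s * (f s - f 0) ^ m))) + s ^ (k + 1) * A s := by
    have : {ξ}ᶜ ∩ U ∈ 𝓝 (0 : ℂ) :=
      Filter.inter_mem (isOpen_compl_singleton.mem_nhds (by simpa using hξ0.symm)) (hU.mem_nhds h0)
    filter_upwards [this] with s hs
    have hs1 : s ≠ ξ := hs.1
    have hs2 : f s ≠ f ξ := fun e => hs1 (hinj hs.2 hξ e)
    have hs1' := sub_ne_zero.2 hs1
    have hs2' := sub_ne_zero.2 hs2
    have hsl : f s - f 0 = s * dslope f 0 s := by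
      have := sub_smul_dslope f 0 s
      simpa using this.symm
    have geo : ∀ (x v : ℂ), v ≠ 0 → x - v ≠ 0 →
        1 / (x - v) = -(∑ m ∈ Finset.range (k + 1), 1 / v ^ (m + 1) * x ^ m)
          + x ^ (k + 1) / (v ^ (k + 1) * (x - v)) := by
      intro x v hv hx
      have key : ∀ K : ℕ, (∑ m ∈ Finset.range K, 1 / v ^ (m + 1) * x ^ m) * (v ^ K * (x - v))
          = x ^ K - v ^ K := by
        intro K
        induction K with
        | zero => simp
        | succ K ih =>
          rw [Finset.sum_range_succ, add_mul, pow_succ v K]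
          have : (∑ m ∈ Finset.range K, 1 / v ^ (m + 1) * x ^ m) * (v ^ K * v * (x - v))
            = (x ^ K - v ^ K) * v := by rw [← ih]; ring
          rw [this]
          field_simp
          ring
      have hk := key (k + 1)
      have : (∑ m ∈ Finset.range (k + 1), 1 / v ^ (m + 1) * x ^ m)
          = (x ^ (k + 1) - v ^ (k + 1)) / (v ^ (k + 1) * (x - v)) := by
        rw [eq_div_iff (by positivity), hk]
      rw [this]
      field_simp
      ring
    rw [regKernel_of_ne hs1 hs2, hAdef]
    have g1 := geo s ξ hξ0 hs1'
    have g2 := geo (f s - f 0) (f ξ - f 0) hv (by simpa using hs2')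
    rw [sub_sub_sub_cancel_right] at g2
    rw [div_eq_mul_one_div (deriv f s), g1, g2, Finset.sum_sub_distrib]
    have : ∑ m ∈ Finset.range (k + 1), 1 / (f ξ - f 0) ^ (m + 1) * (deriv f s * (f s - f 0) ^ m)
        = deriv f s * ∑ m ∈ Finset.range (k + 1), 1 / (f ξ - f 0) ^ (m + 1) * (f s - f 0) ^ m := by
      rw [Finset.mul_sum]; exact Finset.sum_congr rfl fun m _ => by ring
    rw [this]
    generalize ∑ m ∈ Finset.range (k + 1), 1 / (f ξ - f 0) ^ (m + 1) * (f s - f 0) ^ m = S1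
    generalize ∑ m ∈ Finset.range (k + 1), 1 / ξ ^ (m + 1) * s ^ m = S2
    rw [hsl, mul_pow]
    ring
  have hda := hfa.deriv
  have c1 : ∀ m, ContDiffAt ℂ k (fun s : ℂ => 1 / ξ ^ (m + 1) * s ^ m) 0 := fun m => by fun_prop
  have c0 : ∀ m, ContDiffAt ℂ k (fun s : ℂ => deriv f s * (f s - f 0) ^ m) 0 := fun m =>
    AnalyticAt.contDiffAt (by fun_prop)
  have c2 : ∀ m, ContDiffAt ℂ k
      (fun s : ℂ => 1 / (f ξ - f 0) ^ (m + 1) * (deriv f s * (f s - f 0) ^ m)) 0 := fun m =>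
    contDiffAt_const.mul (c0 m)
  have hp := taylorCoeff_pow_mul hA k
  rw [taylorCoeff] at hp ⊢
  rw [hev.iteratedDeriv_eq k]
  have c3 : ContDiffAt ℂ k (fun s => s ^ (k + 1) * A s) 0 := by
    have := hA.contDiffAt (n := k)
    fun_prop
  have step := iteratedDeriv_add (n := k) (x := (0 : ℂ))
    (f := fun s => ∑ m ∈ Finset.range (k + 1), (1 / ξ ^ (m + 1) * s ^ m
        - 1 / (f ξ - f 0) ^ (m + 1) * (deriv f s * (f s - f 0) ^ m)))
    (g := fun s => s ^ (k + 1) * A s) (ContDiffAt.sum fun m _ => (c1 m).sub (c2 m)) c3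
  refine (congrArg (· / (k.factorial : ℂ)) step).trans ?_
  simp only [add_div, hp, add_zero]
  rw [iteratedDeriv_fun_sum fun m _ => (c1 m).sub (c2 m)]
  have hm : ∀ m, iteratedDeriv k (fun s => 1 / ξ ^ (m + 1) * s ^ m
        - 1 / (f ξ - f 0) ^ (m + 1) * (deriv f s * (f s - f 0) ^ m)) 0
      = (if k = m then (k.factorial : ℂ) * (1 / ξ ^ (m + 1)) else 0) - 1 / (f ξ - f 0) ^ (m + 1) *
        iteratedDeriv k (fun s => deriv f s * (f s - f 0) ^ m) 0 := by
    intro m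
    refine (iteratedDeriv_sub (c1 m) (c2 m)).trans ?_
    rw [iteratedDeriv_const_mul_field, iteratedDeriv_const_mul_field, iteratedDeriv_fun_pow_zero]
    split_ifs with h
    · rw [h]; ring
    · simp
  simp only [hm]
  have hk : (k.factorial : ℂ) ≠ 0 := by exact_mod_cast k.factorial_ne_zero
  rw [Finset.sum_sub_distrib, Finset.sum_ite_eq, if_pos (by simp), sub_div, Finset.sum_div]
  congr 1
  · field_simp
  · refine Finset.sum_congr rfl fun m _ => ?_
    rw [taylorCoeff]
    field_simp

end SzegoCauchy

/-! ### The phase function and its normal form at the saddle point -/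

namespace SzegoCauchy

/-- The logarithm is expanded to order four because the two computed Taylor coefficients of g_0
require φ up to an error O((z - 1)⁵). -/
theorem norm_phi_sub_le {z : ℂ} (hz : ‖z - 1‖ ≤ 1 / 2) :
    ‖phi z - ((z - 1) ^ 2 / 2 - (z - 1) ^ 3 / 3 + (z - 1) ^ 4 / 4)‖ ≤ ‖z - 1‖ ^ 5 := by
  have h := Complex.norm_log_sub_logTaylor_le 4 (z := z - 1) (by linarith)
  have e : phi z - ((z - 1) ^ 2 / 2 - (z - 1) ^ 3 / 3 + (z - 1) ^ 4 / 4)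
      = -(Complex.log (1 + (z - 1)) - Complex.logTaylor (4 + 1) (z - 1)) := by
    simp only [Complex.logTaylor, phi, Finset.sum_range_succ, Finset.sum_range_zero]
    rw [add_sub_cancel]
    push_cast
    ring
  rw [e, norm_neg]
  refine h.trans ?_
  have h1 : (1 - ‖z - 1‖)⁻¹ ≤ 2 := by
    rw [inv_le_comm₀ (by linarith) (by norm_num)]; linarith
  have h2 : 0 ≤ ‖z - 1‖ ^ 5 := by positivity
  push_cast
  nlinarith [mul_le_mul_of_nonneg_left h1 h2]

theorem phi_one : phi 1 = 0 := by simp [phi]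

theorem exp_nat_mul_phi {s : ℂ} (hs : s ≠ 0) (n : ℕ) :
    Complex.exp (n * phi s) = (s ^ n)⁻¹ * Complex.exp (n * (s - 1)) := by
  rw [phi, mul_sub, Complex.exp_sub, Complex.exp_nat_mul, Complex.exp_nat_mul, Complex.exp_log hs]
  field_simp

theorem phi_re (s : ℂ) : (phi s).re = s.re - 1 - Real.log ‖s‖ := by
  simp [phi, Complex.log_re]

theorem phi_im (s : ℂ) : (phi s).im = s.im - s.arg := by
  simp [phi, Complex.log_im]

theorem norm_pow_inv_mul_exp {s : ℂ} (hs : s ≠ 0) (n : ℕ) :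
    ‖(s ^ n)⁻¹ * Complex.exp (n * (s - 1))‖ = Real.exp (n * (phi s).re) := by
  rw [← exp_nat_mul_phi hs, Complex.norm_exp]
  simp

theorem phi_re_nonneg_of_pos {x : ℝ} (hx : 0 < x) : 0 ≤ (phi x).re := by
  rw [phi_re, Complex.norm_real, Real.norm_eq_abs, abs_of_pos hx, Complex.ofReal_re]
  linarith [Real.log_le_sub_one_of_pos hx]

/-- Here Re z - 1 = ln|z| and y = Im z equals arg z. If y = 0, then z = |z| > 0 and ln x < x - 1 for
x ≠ 1 decides. Otherwise |y| = |z||sin y| ≤ |z||y| gives |z| ≥ 1, hence Re z ≥ 1 and |y| < π/2. Then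
|y| < tan|y| yields |y| Re z < |z| sin|y| = |y|, so Re z < 1, a contradiction. -/
theorem eq_one_of_phi_eq_zero {z : ℂ} (hz : z ≠ 0) (h : phi z = 0) : z = 1 := by
  have hre : z.re - 1 = Real.log ‖z‖ := by
    have := congrArg Complex.re h; rw [phi_re, Complex.zero_re] at this; linarith
  have him : z.im = z.arg := by
    have := congrArg Complex.im h; rw [phi_im, Complex.zero_im] at this; linarith
  have hn : 0 < ‖z‖ := norm_pos_iff.2 hz
  have hc := Complex.norm_mul_cos_arg z
  have hs := Complex.norm_mul_sin_arg z
  rw [← him] at hc hs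
  have hlog := Real.one_sub_inv_le_log_of_pos hn
  by_cases hy : z.im = 0
  · rw [hy, Real.cos_zero, mul_one] at hc
    have : ‖z‖ = 1 := by
      by_contra hne
      have := Real.log_lt_sub_one_of_pos hn hne
      linarith
    apply Complex.ext
    · rw [← hc, this]; simp
    · simpa using hy
  · exfalso
    have hr1 : 1 ≤ ‖z‖ := by
      have h1 : |z.im| ≤ ‖z‖ * |z.im| := by
        conv_lhs => rw [← hs, abs_mul, abs_of_pos hn]
        exact mul_le_mul_of_nonneg_left Real.abs_sin_le_abs hn.le
      have h2 : 0 < |z.im| := abs_pos.2 hy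
      nlinarith
    have hlog0 : 0 ≤ Real.log ‖z‖ := Real.log_nonneg hr1
    have hre1 : 1 ≤ z.re := by linarith
    have hy1 : |z.im| < π / 2 := by
      rw [him, Complex.abs_arg_lt_pi_div_two_iff]; left; linarith
    have hcos : 0 < Real.cos z.im := Real.cos_pos_of_mem_Ioo ⟨by linarith [neg_abs_le z.im], by linarith [le_abs_self z.im]⟩
    have key : z.re < 1 := by
      have htan : |z.im| < Real.tan |z.im| := Real.lt_tan (abs_pos.2 hy) hy1
      have hcosa : Real.cos |z.im| = Real.cos z.im := Real.cos_abs _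
      rw [Real.tan_eq_sin_div_cos, hcosa, lt_div_iff₀ hcos] at htan
      have hsa : ‖z‖ * Real.sin |z.im| = |z.im| := by
        rcases abs_cases z.im with ⟨h1, _⟩ | ⟨h1, _⟩
        · rw [h1, hs]
        · rw [h1, Real.sin_neg]; linarith
      have : |z.im| * z.re < |z.im| * 1 := by
        rw [← hc]
        calc |z.im| * (‖z‖ * Real.cos z.im) = ‖z‖ * (|z.im| * Real.cos z.im) := by ring
          _ < ‖z‖ * Real.sin |z.im| := by gcongr
          _ = |z.im| * 1 := by rw [hsa, mul_one]
      exact lt_of_mul_lt_mul_left this (abs_nonneg _)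
    linarith

theorem eq_one_of_mem_descentPath_of_re_eq_zero {z : ℂ} (h : z ∈ descentPath)
    (h0 : (phi z).re = 0) : z = 1 :=
  eq_one_of_phi_eq_zero h.1 (Complex.ext h0 h.2.1)

theorem tendsto_phi_div_sq :
    Filter.Tendsto (fun z : ℂ => phi z / (z - 1) ^ 2) (𝓝[≠] 1) (𝓝 (1 / 2)) := by
  rw [tendsto_iff_norm_sub_tendsto_zero]
  have hlim : Filter.Tendsto (fun z : ℂ => ‖z - 1‖ / 3 + ‖z - 1‖ ^ 2 / 4 + ‖z - 1‖ ^ 3)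
      (𝓝[≠] 1) (𝓝 0) := by
    have : Continuous (fun z : ℂ => ‖z - 1‖ / 3 + ‖z - 1‖ ^ 2 / 4 + ‖z - 1‖ ^ 3) := by fun_prop
    have := this.tendsto 1
    simp only [sub_self, norm_zero, zero_div, ne_eq, OfNat.ofNat_ne_zero, not_false_eq_true,
      zero_pow, add_zero] at this
    exact this.mono_left nhdsWithin_le_nhds
  refine squeeze_zero' (Filter.Eventually.of_forall fun _ => norm_nonneg _) ?_ hlim
  have hb : Metric.closedBall (1 : ℂ) (1 / 2) ∈ 𝓝[≠] (1 : ℂ) :=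
    mem_nhdsWithin_of_mem_nhds (Metric.closedBall_mem_nhds _ (by norm_num))
  filter_upwards [hb, self_mem_nhdsWithin] with z hz hz1
  have hz' : ‖z - 1‖ ≤ 1 / 2 := by simpa [dist_eq_norm] using hz
  have hw : z - 1 ≠ 0 := sub_ne_zero.2 hz1
  have h := norm_phi_sub_le hz'
  have hpos : 0 < ‖z - 1‖ := norm_pos_iff.2 hw
  have e : phi z / (z - 1) ^ 2 - 1 / 2 = (phi z - ((z - 1) ^ 2 / 2 - (z - 1) ^ 3 / 3
      + (z - 1) ^ 4 / 4)) / (z - 1) ^ 2 + (-((z - 1) / 3) + (z - 1) ^ 2 / 4) := by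
    field_simp; ring
  rw [e]
  have h2 : ‖(phi z - ((z - 1) ^ 2 / 2 - (z - 1) ^ 3 / 3
      + (z - 1) ^ 4 / 4)) / (z - 1) ^ 2‖ ≤ ‖z - 1‖ ^ 3 := by
    rw [norm_div, norm_pow, div_le_iff₀ (by positivity)]
    calc _ ≤ _ := h
      _ = _ := by ring
  have h3 : ‖-((z - 1) / 3) + (z - 1) ^ 2 / 4‖ ≤ ‖z - 1‖ / 3 + ‖z - 1‖ ^ 2 / 4 := by
    refine (norm_add_le _ _).trans ?_
    simp
  linarith [norm_add_le ((phi z - ((z - 1) ^ 2 / 2 - (z - 1) ^ 3 / 3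
      + (z - 1) ^ 4 / 4)) / (z - 1) ^ 2) (-((z - 1) / 3) + (z - 1) ^ 2 / 4)]

theorem differentiableOn_phi : DifferentiableOn ℂ phi Complex.slitPlane := by
  intro z hz
  unfold phi
  exact ((differentiableAt_id.sub_const _).sub
    (Complex.differentiableAt_log hz)).differentiableWithinAt

/-- A holomorphic square root of `φ` near its double zero `1`. -/
theorem exists_analyticAt_sq_eq_phi : ∃ ψ : ℂ → ℂ, AnalyticAt ℂ ψ 1 ∧ ψ 1 = 0 ∧
    HasDerivAt ψ ((√2 : ℝ) : ℂ)⁻¹ 1 ∧ ∀ᶠ z in 𝓝 1, ψ z ^ 2 = phi z := by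
  have hslit : Complex.slitPlane ∈ 𝓝 (1 : ℂ) :=
    Complex.isOpen_slitPlane.mem_nhds Complex.one_mem_slitPlane
  have hd1 := (Complex.differentiableOn_dslope hslit).2 differentiableOn_phi
  set D := dslope phi 1 with hD
  have hd2 := (Complex.differentiableOn_dslope hslit).2 hd1
  set D2 := dslope D 1 with hD2
  have hD1 : D 1 = 0 := by
    rw [hD, dslope_same]
    have : HasDerivAt phi (1 - 1⁻¹) 1 := by
      unfold phi
      exact ((hasDerivAt_id _).sub_const _).sub (Complex.hasDerivAt_log Complex.one_mem_slitPlane)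
    simpa using this.deriv
  -- Both φ and φ' vanish at 1, so two divided differences extract the factor (z - 1)².
  have hphi : ∀ z, phi z = (z - 1) ^ 2 * D2 z := by
    intro z
    have h1 := sub_smul_dslope phi 1 z
    have h2 := sub_smul_dslope D 1 z
    rw [phi_one, sub_zero, smul_eq_mul] at h1
    rw [hD1, sub_zero, smul_eq_mul] at h2
    rw [← h1, ← hD, ← h2]; ring
  have hD2a : AnalyticAt ℂ D2 1 := hd2.analyticAt hslit
  have hD21 : D2 1 = 1 / 2 := by
    have h1 : Filter.Tendsto D2 (𝓝[≠] 1) (𝓝 (D2 1)) :=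
      hD2a.continuousAt.tendsto.mono_left nhdsWithin_le_nhds
    refine tendsto_nhds_unique h1 (tendsto_phi_div_sq.congr' ?_)
    filter_upwards [self_mem_nhdsWithin] with z hz
    have : z - 1 ≠ 0 := sub_ne_zero.2 hz
    rw [hphi]; field_simp
  have h2D : 2 * D2 1 = 1 := by rw [hD21]; norm_num
  -- The factor 2 normalizes the value at 1 to 1, well inside the slit plane, so that exp(log/2) is
  -- a holomorphic square root there; the factor 1/√2 in the witness undoes it.
  have hE : AnalyticAt ℂ (fun z => Complex.exp (Complex.log (2 * D2 z) / 2)) 1 := by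
    have : AnalyticAt ℂ (fun z => Complex.log (2 * D2 z)) 1 :=
      AnalyticAt.clog (by fun_prop) (by rw [h2D]; exact Complex.one_mem_slitPlane)
    fun_prop
  have hsq : (((√2 : ℝ) : ℂ)) ^ 2 = 2 := by
    rw [← Complex.ofReal_pow, Real.sq_sqrt (by norm_num)]; norm_num
  refine ⟨fun z => (z - 1) * (((√2 : ℝ) : ℂ)⁻¹ * Complex.exp (Complex.log (2 * D2 z) / 2)),
    by fun_prop, by simp, ?_, ?_⟩
  · have h1 : HasDerivAt (fun z : ℂ => z - 1) 1 1 := (hasDerivAt_id _).sub_const _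
    have h2 := (hE.differentiableAt.hasDerivAt).const_mul (((√2 : ℝ) : ℂ)⁻¹)
    have := h1.mul h2
    refine this.congr_deriv ?_
    simp [h2D]
  · have hne : ∀ᶠ z in 𝓝 1, 2 * D2 z ≠ 0 := by
      have : ContinuousAt (fun z => 2 * D2 z) 1 := by
        have := hD2a.continuousAt; fun_prop
      exact this.eventually_ne (by rw [h2D]; exact one_ne_zero)
    filter_upwards [hne] with z hz
    rw [hphi, mul_pow, mul_pow, ← Complex.exp_nat_mul]
    push_cast
    rw [mul_div_cancel₀ _ (two_ne_zero), Complex.exp_log hz, inv_pow, hsq]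
    ring

/-- The local inverse of the square root ψ of φ is λ: squaring ψ(λ(ξ)) = ξ gives φ(λ(ξ)) = ξ², and
λ'(0) = 1/ψ'(1) = √2. The disc is shrunk until ψ is differentiable with nonzero derivative on its
image, which makes both directions holomorphic. -/
theorem exists_isNormalForm :
    ∃ (lam : OpenPartialHomeomorph ℂ ℂ) (δ₀ : ℝ), IsNormalForm lam δ₀ := by
  obtain ⟨ψ, hψ, hψ1, hψd, hsq⟩ := exists_analyticAt_sq_eq_phi
  have hc : ((√2 : ℝ) : ℂ)⁻¹ ≠ 0 := by simp
  have hstrict : HasStrictDerivAt ψ (((√2 : ℝ) : ℂ)⁻¹) 1 := by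
    have := hψ.hasStrictDerivAt
    rwa [hψd.deriv] at this
  set e := (hstrict.hasStrictFDerivAt_equiv hc).toOpenPartialHomeomorph ψ with he
  have hecoe : (e : ℂ → ℂ) = ψ := rfl
  have h1s : (1 : ℂ) ∈ e.source :=
    (hstrict.hasStrictFDerivAt_equiv hc).mem_toOpenPartialHomeomorph_source
  have h0t : (0 : ℂ) ∈ e.target := by
    have := e.map_source h1s
    rwa [hecoe, hψ1] at this
  have hs0 : e.symm 0 = 1 := by
    have := e.left_inv h1s
    rwa [hecoe, hψ1] at this
  have hgood : ∀ᶠ z in 𝓝 (1 : ℂ), ψ z ^ 2 = phi z ∧ DifferentiableAt ℂ ψ z ∧ deriv ψ z ≠ 0 := by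
    refine hsq.and ((hψ.eventually_analyticAt.mono fun z h => h.differentiableAt).and ?_)
    exact hψ.deriv.continuousAt.eventually_ne (by rw [hψd.deriv]; exact hc)
  have hpre : ∀ᶠ ξ in 𝓝 (0 : ℂ), ξ ∈ e.target ∧ (ψ (e.symm ξ) ^ 2 = phi (e.symm ξ) ∧
      DifferentiableAt ℂ ψ (e.symm ξ) ∧ deriv ψ (e.symm ξ) ≠ 0) := by
    refine Filter.Eventually.and (e.open_target.mem_nhds h0t) ?_
    have : Filter.Tendsto e.symm (𝓝 0) (𝓝 1) := by
      have := e.continuousAt_symm h0t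
      rwa [ContinuousAt, hs0] at this
    exact this.eventually hgood
  obtain ⟨δ, hδ, hball⟩ := Metric.eventually_nhds_iff_ball.1 hpre
  have hsrc : (e.symm.restrOpen (Metric.ball 0 δ) Metric.isOpen_ball).source
      = Metric.ball 0 δ := by
    rw [OpenPartialHomeomorph.restrOpen_source]
    exact Set.inter_eq_right.2 fun ξ hξ => (hball ξ hξ).1
  have hder : ∀ ξ ∈ Metric.ball (0 : ℂ) δ, HasDerivAt e.symm (deriv ψ (e.symm ξ))⁻¹ ξ := by
    intro ξ hξ
    obtain ⟨h1, -, h2, h3⟩ := hball ξ hξ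
    exact e.hasDerivAt_symm h1 h3 h2.hasDerivAt
  refine ⟨e.symm.restrOpen (Metric.ball 0 δ) Metric.isOpen_ball, δ, hδ, hsrc, ?_, ?_, hs0, ?_, ?_⟩
  · rw [hsrc]
    exact fun ξ hξ => (hder ξ hξ).differentiableAt.differentiableWithinAt
  · intro z hz
    have hm := (e.symm.restrOpen (Metric.ball 0 δ) Metric.isOpen_ball).map_target hz
    have hr := (e.symm.restrOpen (Metric.ball 0 δ) Metric.isOpen_ball).right_inv hz
    rw [hsrc] at hm
    have h2 := (hball _ hm).2.2.1
    have : e.symm ((e.symm.restrOpen (Metric.ball 0 δ) Metric.isOpen_ball).symm z) = z := hr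
    rw [this] at h2
    exact h2.differentiableWithinAt
  · have := (hder 0 (Metric.mem_ball_self hδ)).deriv
    rw [hs0, hψd.deriv, inv_inv] at this
    exact this
  · intro ξ hξ
    obtain ⟨h1, h2, -⟩ := hball ξ hξ
    have h3 : ψ (e.symm ξ) = ξ := e.right_inv h1
    rw [h3] at h2
    exact h2.symm

end SzegoCauchy

/-! ### Gaussian moments, Laplace's method and the integral along the descent path -/

namespace SzegoCauchy

open MeasureTheory

theorem integrable_pow_mul_exp_neg_mul_sq {b : ℝ} (hb : 0 < b) (k : ℕ) :
    Integrable fun u : ℝ => u ^ k * Real.exp (-b * u ^ 2) := by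
  have := integrable_rpow_mul_exp_neg_mul_sq hb (s := k) (by linarith [k.cast_nonneg (α := ℝ)])
  simpa using this

theorem integral_even_pow_mul_exp_neg_mul_sq {b : ℝ} (hb : 0 < b) (j : ℕ) :
    ∫ u : ℝ, u ^ (2 * j) * Real.exp (-b * u ^ 2) = Real.Gamma (j + 1 / 2) / (b ^ j * √b) := by
  have h1 : ∫ u : ℝ, u ^ (2 * j) * Real.exp (-b * u ^ 2)
      = ∫ u : ℝ, (fun x : ℝ => x ^ (2 * j) * Real.exp (-b * x ^ 2)) |u| := by
    refine integral_congr_ae (Filter.Eventually.of_forall fun u => ?_)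
    simp only [pow_mul, sq_abs]
  have h2 := integral_rpow_mul_exp_neg_mul_rpow (p := 2) (q := 2 * j) (b := b) two_pos
    (by linarith [j.cast_nonneg (α := ℝ)]) hb
  have h3 : ∫ x in Set.Ioi (0 : ℝ), x ^ (2 * j) * Real.exp (-b * x ^ 2)
      = ∫ x in Set.Ioi (0 : ℝ), x ^ (2 * j : ℝ) * Real.exp (-b * x ^ (2 : ℝ)) := by
    refine integral_congr_ae (Filter.Eventually.of_forall fun u => ?_)
    simp only [Real.rpow_two]
    congr 1
    exact_mod_cast (Real.rpow_natCast u (2 * j)).symm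
  rw [h1, integral_comp_abs (f := fun x : ℝ => x ^ (2 * j) * Real.exp (-b * x ^ 2)), h3, h2]
  have e1 : (2 * (j : ℝ) + 1) / 2 = j + 1 / 2 := by ring
  have e2 : -(2 * (j : ℝ) + 1) / 2 = -(j + 1 / 2) := by ring
  rw [e1, e2, Real.rpow_neg hb.le, Real.rpow_add hb, Real.rpow_natCast, Real.sqrt_eq_rpow]
  field_simp

theorem integral_odd_pow_mul_exp_neg_mul_sq (b : ℝ) (j : ℕ) :
    ∫ u : ℝ, u ^ (2 * j + 1) * Real.exp (-b * u ^ 2) = 0 := by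
  have h := integral_neg_eq_self (fun u : ℝ => u ^ (2 * j + 1) * Real.exp (-b * u ^ 2)) volume
  have h2 : ∫ u : ℝ, (-u) ^ (2 * j + 1) * Real.exp (-b * (-u) ^ 2)
      = - ∫ u : ℝ, u ^ (2 * j + 1) * Real.exp (-b * u ^ 2) := by
    rw [← integral_neg]
    refine integral_congr_ae (Filter.Eventually.of_forall fun u => ?_)
    simp only [neg_sq, (odd_two_mul_add_one j).neg_pow]
    ring
  rw [h2] at h
  linarith

theorem integral_exp_mul_I_mul_pow {b : ℝ} (hb : 0 < b) (k : ℕ) :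
    Integrable (fun u : ℝ => (Real.exp (-b * u ^ 2) : ℂ) * (Complex.I * u) ^ k) ∧
    ∫ u : ℝ, (Real.exp (-b * u ^ 2) : ℂ) * (Complex.I * u) ^ k =
      if Even k then ((-1) ^ (k / 2) * (Real.Gamma ((k / 2 : ℕ) + 1 / 2) / (b ^ (k / 2) * √b)) : ℝ)
        else 0 := by
  have e : (fun u : ℝ => (Real.exp (-b * u ^ 2) : ℂ) * (Complex.I * u) ^ k)
      = fun u : ℝ => Complex.I ^ k * ((u ^ k * Real.exp (-b * u ^ 2) : ℝ) : ℂ) := by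
    funext u; push_cast; ring
  rw [e]
  refine ⟨(integrable_pow_mul_exp_neg_mul_sq hb k).ofReal.const_mul _, ?_⟩
  rw [integral_const_mul, integral_complex_ofReal]
  split_ifs with hk
  · obtain ⟨j, rfl⟩ := hk
    rw [← two_mul, integral_even_pow_mul_exp_neg_mul_sq hb, Nat.mul_div_cancel_left _ two_pos,
      pow_mul, Complex.I_sq]
    push_cast
    ring
  · obtain ⟨j, rfl⟩ := Nat.not_even_iff_odd.1 hk
    rw [integral_odd_pow_mul_exp_neg_mul_sq]
    simp

theorem sum_range_two_mul_ite_even (f : ℕ → ℂ) (r : ℕ) :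
    ∑ k ∈ Finset.range (2 * r), (if Even k then f k else 0) =
      ∑ j ∈ Finset.range r, f (2 * j) := by
  induction r with
  | zero => simp
  | succ r ih =>
    rw [mul_add, mul_one, Finset.sum_range_succ, Finset.sum_range_succ, ih, Finset.sum_range_succ]
    simp

/-- Laplace's method for an integrand with a Taylor bound valid on the whole line. -/
theorem norm_laplace_sub_le {H : ℝ → ℂ} (hH : AEStronglyMeasurable H) {c : ℕ → ℂ} {C : ℝ} {r : ℕ}
    (hb : ∀ u : ℝ, ‖H u - ∑ k ∈ Finset.range (2 * r), c k * (Complex.I * u) ^ k‖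
      ≤ C * u ^ (2 * r)) {b : ℝ} (hb0 : 0 < b) :
    ‖(∫ u : ℝ, (Real.exp (-b * u ^ 2) : ℂ) * H u) - ∑ j ∈ Finset.range r,
      (-1) ^ j * (Real.Gamma (j + 1 / 2) : ℂ) * c (2 * j) / (b ^ j * (√b : ℝ))‖
      ≤ C * Real.Gamma (r + 1 / 2) / (b ^ r * √b) := by
  set p : ℝ → ℂ := fun u => ∑ k ∈ Finset.range (2 * r), c k * (Complex.I * u) ^ k with hp
  have hpi : ∀ k ∈ Finset.range (2 * r), Integrable fun u : ℝ =>
      c k * ((Real.exp (-b * u ^ 2) : ℂ) * (Complex.I * u) ^ k) := fun k _ =>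
    (integral_exp_mul_I_mul_pow hb0 k).1.const_mul _
  have hpe : (fun u : ℝ => (Real.exp (-b * u ^ 2) : ℂ) * p u) = fun u : ℝ =>
      ∑ k ∈ Finset.range (2 * r), c k * ((Real.exp (-b * u ^ 2) : ℂ) * (Complex.I * u) ^ k) := by
    funext u
    rw [hp, Finset.mul_sum]
    exact Finset.sum_congr rfl fun k _ => by ring
  have hpint : Integrable fun u : ℝ => (Real.exp (-b * u ^ 2) : ℂ) * p u := by
    rw [hpe]; exact integrable_finsetSum _ hpi
  have hpval : ∫ u : ℝ, (Real.exp (-b * u ^ 2) : ℂ) * p u = ∑ j ∈ Finset.range r,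
      (-1) ^ j * (Real.Gamma (j + 1 / 2) : ℂ) * c (2 * j) / (b ^ j * (√b : ℝ)) := by
    rw [hpe, integral_finsetSum _ hpi]
    have : ∀ k ∈ Finset.range (2 * r),
        ∫ u : ℝ, c k * ((Real.exp (-b * u ^ 2) : ℂ) * (Complex.I * u) ^ k) = if Even k then
        c k * ((-1) ^ (k / 2) * (Real.Gamma ((k / 2 : ℕ) + 1 / 2) / (b ^ (k / 2) * √b)) : ℝ)
        else 0 := by
      intro k _
      rw [integral_const_mul, (integral_exp_mul_I_mul_pow hb0 k).2]
      split_ifs <;> simp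
    -- The odd moments vanish, so 2r Taylor terms leave r terms of the expansion.
    rw [Finset.sum_congr rfl this, sum_range_two_mul_ite_even]
    refine Finset.sum_congr rfl fun j _ => ?_
    rw [Nat.mul_div_cancel_left _ two_pos]
    push_cast
    ring
  have hgi : Integrable fun u : ℝ => C * (u ^ (2 * r) * Real.exp (-b * u ^ 2)) :=
    (integrable_pow_mul_exp_neg_mul_sq hb0 _).const_mul _
  have hpc : Continuous p := by
    rw [hp]; fun_prop
  have hmeas : AEStronglyMeasurable fun u : ℝ => (Real.exp (-b * u ^ 2) : ℂ) * (H u - p u) := by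
    refine AEStronglyMeasurable.mul ?_ (hH.sub hpc.aestronglyMeasurable)
    exact Continuous.aestronglyMeasurable (by fun_prop)
  have hbd : ∀ u : ℝ, ‖(Real.exp (-b * u ^ 2) : ℂ) * (H u - p u)‖
      ≤ C * (u ^ (2 * r) * Real.exp (-b * u ^ 2)) := by
    intro u
    rw [norm_mul, Complex.norm_real, Real.norm_eq_abs, abs_of_pos (Real.exp_pos _)]
    calc _ ≤ Real.exp (-b * u ^ 2) * (C * u ^ (2 * r)) :=
          mul_le_mul_of_nonneg_left (hb u) (Real.exp_pos _).le
      _ = _ := by ring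
  have hdi : Integrable fun u : ℝ => (Real.exp (-b * u ^ 2) : ℂ) * (H u - p u) :=
    hgi.mono' hmeas (Filter.Eventually.of_forall hbd)
  have hsplit : ∫ u : ℝ, (Real.exp (-b * u ^ 2) : ℂ) * H u =
      (∫ u : ℝ, (Real.exp (-b * u ^ 2) : ℂ) * (H u - p u))
        + ∫ u : ℝ, (Real.exp (-b * u ^ 2) : ℂ) * p u := by
    rw [← integral_add hdi hpint]
    refine integral_congr_ae (Filter.Eventually.of_forall fun u => ?_)
    simp only []
    ring
  rw [hsplit, hpval, add_sub_cancel_right]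
  calc _ ≤ ∫ u : ℝ, C * (u ^ (2 * r) * Real.exp (-b * u ^ 2)) :=
        norm_integral_le_of_norm_le hgi (Filter.Eventually.of_forall hbd)
    _ = _ := by
        rw [integral_const_mul, integral_even_pow_mul_exp_neg_mul_sq hb0]
        ring

/-- The part over `u ∈ [-a, a]` of the contour integral, in the coordinate `s = f (i u)`. -/
noncomputable def localIntegral (f : ℂ → ℂ) (a : ℝ) (n : ℕ) (z : ℂ) : ℂ :=
  ∫ u in (-a)..a, (Real.exp (-n * u ^ 2) : ℂ) *
    (Complex.I * deriv f (Complex.I * u) / (f (Complex.I * u) - z))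

theorem norm_I_mul_ofReal (u : ℝ) : ‖Complex.I * (u : ℂ)‖ = |u| := by simp

theorem I_mul_ofReal_ne {ξ : ℂ} (hξ : ξ.re ≠ 0) (u : ℝ) : Complex.I * (u : ℂ) ≠ ξ := by
  rintro rfl; simp at hξ

theorem add_I_mul_ne_zero {ξ : ℂ} (hξ : ξ.re ≠ 0) (u : ℝ) : (u : ℂ) + Complex.I * ξ ≠ 0 := by
  intro h
  have := congrArg Complex.im h
  simp at this
  exact hξ this

theorem integrable_exp_div_add_I_mul {ξ : ℂ} (hξ : ξ.re ≠ 0) {b : ℝ} (hb : 0 < b) :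
    Integrable fun u : ℝ => (Real.exp (-b * u ^ 2) : ℂ) * (1 / ((u : ℂ) + Complex.I * ξ)) := by
  have h1 : Integrable fun u : ℝ => (Real.exp (-b * u ^ 2) : ℂ) :=
    (integrable_exp_neg_mul_sq hb).ofReal
  refine h1.mul_bdd (c := 1 / |ξ.re|) ?_ (Filter.Eventually.of_forall fun u => ?_)
  · exact Continuous.aestronglyMeasurable
      (continuous_const.div (by fun_prop) (add_I_mul_ne_zero hξ))
  · rw [norm_div, norm_one]
    have := Complex.abs_im_le_norm ((u : ℂ) + Complex.I * ξ)
    simp only [Complex.add_im, Complex.ofReal_im, Complex.mul_im, Complex.I_re, Complex.I_im,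
      zero_mul, one_mul, zero_add] at this
    exact one_div_le_one_div_of_le (abs_pos.2 hξ) this

/-- Replacing u by √n u moves n from the pole to the Gaussian, so that the parametrix and the local
integral carry the same weight e^{-nu²}. -/
theorem P_eq_integral (lam : OpenPartialHomeomorph ℂ ℂ) {n : ℕ} (hn : 1 ≤ n) (z : ℂ) :
    P lam n z = (2 * π * Complex.I)⁻¹ * ∫ u : ℝ, (Real.exp (-n * u ^ 2) : ℂ) *
      (1 / ((u : ℂ) + Complex.I * lam.symm z)) := by
  rw [P, h]
  congr 1
  have hn0 : (0 : ℝ) < √(n : ℝ) := Real.sqrt_pos.2 (by exact_mod_cast hn)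
  have := Measure.integral_comp_mul_left (fun u : ℝ => Complex.exp (-(u : ℂ) ^ 2) /
    ((u : ℂ) - -Complex.I * (√(n : ℝ) : ℝ) * lam.symm z)) (√(n : ℝ))
  rw [abs_of_pos (inv_pos.2 hn0)] at this
  rw [eq_comm, inv_smul_eq_iff₀ hn0.ne', ← integral_smul] at this
  rw [this]
  refine integral_congr_ae (Filter.Eventually.of_forall fun u => ?_)
  have hc : ((√(n : ℝ) : ℝ) : ℂ) ≠ 0 := by exact_mod_cast hn0.ne'
  have hsq : ((√(n : ℝ) : ℝ) : ℂ) ^ 2 = n := by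
    rw [← Complex.ofReal_pow, Real.sq_sqrt (by positivity)]; simp
  simp only [Complex.real_smul]
  push_cast
  rw [mul_pow, hsq]
  have : (√(n : ℝ) : ℝ) * (u : ℂ) - -Complex.I * (√(n : ℝ) : ℝ) * lam.symm z
      = (√(n : ℝ) : ℝ) * ((u : ℂ) + Complex.I * lam.symm z) := by ring
  rw [this, ← mul_div_assoc, mul_div_mul_left _ _ hc, mul_one_div, neg_mul]

/-- Subtracting 1/(u + iξ) cancels the pole of the kernel, leaving i times `regKernel` at iu, with
Taylor bounds uniform in ξ even as ξ approaches the imaginary axis. The kernel is extended by 0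
beyond |u| = R/2. The Taylor inequality survives there with a larger constant, because |u| is
bounded below, so truncation needs no separate estimate. -/
theorem exists_norm_localIntegral_sub_le {f : ℂ → ℂ} {δ R : ℝ} (hR : 0 < R) (hRδ : R < δ)
    (hf : DifferentiableOn ℂ f (Metric.ball 0 δ)) (hinj : Set.InjOn f (Metric.ball 0 δ))
    (hd : ∀ s ∈ Metric.ball (0 : ℂ) δ, deriv f s ≠ 0) {M : ℝ}
    (hM : ∀ ξ : ℂ, ‖ξ‖ ≤ R / 4 → ∀ s ∈ Metric.sphere (0 : ℂ) R, ‖regKernel f ξ s‖ ≤ M) (r : ℕ) :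
    ∃ C : ℝ, 0 ≤ C ∧ ∀ n : ℕ, 1 ≤ n → ∀ ξ : ℂ, ‖ξ‖ ≤ R / 4 → ξ.re ≠ 0 →
      ‖localIntegral f (R / 2) n (f ξ)
        - (∫ u : ℝ, (Real.exp (-n * u ^ 2) : ℂ) * (1 / ((u : ℂ) + Complex.I * ξ)))
        - ∑ j ∈ Finset.range r, (-1) ^ j * (Real.Gamma (j + 1 / 2) : ℂ) *
          (Complex.I * taylorCoeff (regKernel f ξ) (2 * j)) / ((n : ℝ) ^ j * (√(n : ℝ) : ℝ))‖
      ≤ C / ((n : ℝ) ^ r * √(n : ℝ)) := by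
  have hM0 : 0 ≤ M := by
    have := hM 0 (by simp; positivity) (R : ℂ) (by simp [abs_of_pos hR])
    exact (norm_nonneg _).trans this
  set a := R / 2 with ha
  have ha0 : 0 < a := by positivity
  -- The first summand is the Taylor remainder for |u| ≤ a. The others bound 1/(u + iξ) and the
  -- Taylor polynomial for |u| > a, each compared with |u|^(2r).
  set C : ℝ := 2 * M / R ^ (2 * r) + (2 / a / a ^ (2 * r) +
    ∑ k ∈ Finset.range (2 * r), M / R ^ k / a ^ (2 * r - k)) with hC
  have hC2 : 0 ≤ 2 / a / a ^ (2 * r) +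
    ∑ k ∈ Finset.range (2 * r), M / R ^ k / a ^ (2 * r - k) := by
    have : 0 ≤ ∑ k ∈ Finset.range (2 * r), M / R ^ k / a ^ (2 * r - k) :=
      Finset.sum_nonneg fun k _ => by positivity
    positivity
  have hC0 : 0 ≤ C := by positivity
  have hG0 : 0 < Real.Gamma (r + 1 / 2) := Real.Gamma_pos_of_pos (by positivity)
  refine ⟨C * Real.Gamma (r + 1 / 2), by positivity, fun n hn ξ hξ hre => ?_⟩
  have hn0 : (0 : ℝ) < n := by exact_mod_cast hn
  have hξδ : ξ ∈ Metric.ball (0 : ℂ) δ := by rw [mem_ball_zero_iff]; linarith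
  have hiu : ∀ u : ℝ, |u| ≤ a → Complex.I * (u : ℂ) ∈ Metric.ball (0 : ℂ) δ := by
    intro u hu
    rw [mem_ball_zero_iff, norm_I_mul_ofReal]; linarith
  have hne : ∀ u : ℝ, |u| ≤ a → f (Complex.I * u) ≠ f ξ := fun u hu e =>
    I_mul_ofReal_ne hre u (hinj (hiu u hu) hξδ e)
  set K : ℝ → ℂ := fun u => Complex.I * deriv f (Complex.I * u) / (f (Complex.I * u) - f ξ)
    with hK
  have hKc : ContinuousOn K (Set.Icc (-a) a) := by
    have hmaps : Set.MapsTo (fun u : ℝ => Complex.I * (u : ℂ)) (Set.Icc (-a) a)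
        (Metric.ball 0 δ) := fun u hu => hiu u (abs_le.2 hu)
    have c0 : ContinuousOn (fun u : ℝ => Complex.I * (u : ℂ)) (Set.Icc (-a) a) := by fun_prop
    refine ContinuousOn.div (continuousOn_const.mul
      ((hf.deriv Metric.isOpen_ball).continuousOn.comp c0 hmaps))
      ((hf.continuousOn.comp c0 hmaps).sub continuousOn_const) fun u hu => ?_
    exact sub_ne_zero.2 (hne u (abs_le.2 hu))
  set H : ℝ → ℂ := fun u => (Set.Icc (-a) a).indicator K u - 1 / ((u : ℂ) + Complex.I * ξ) with hH
  have hiKi : Integrable fun u : ℝ => (Real.exp (-n * u ^ 2) : ℂ) *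
      (Set.Icc (-a) a).indicator K u := by
    have h1 : IntegrableOn (fun u : ℝ => (Real.exp (-n * u ^ 2) : ℂ) * K u) (Set.Icc (-a) a) := by
      refine ContinuousOn.integrableOn_Icc (ContinuousOn.mul ?_ hKc)
      fun_prop
    have h2 := h1.integrable_indicator measurableSet_Icc
    refine h2.congr (Filter.Eventually.of_forall fun u => ?_)
    simp only [Set.indicator]
    split_ifs <;> simp
  have hq := integrable_exp_div_add_I_mul hre hn0
  have hloc : localIntegral f a n (f ξ) = ∫ u : ℝ, (Real.exp (-n * u ^ 2) : ℂ) *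
      (Set.Icc (-a) a).indicator K u := by
    rw [localIntegral, intervalIntegral.integral_of_le (by linarith), ← integral_Icc_eq_integral_Ioc,
      ← integral_indicator measurableSet_Icc]
    refine integral_congr_ae (Filter.Eventually.of_forall fun u => ?_)
    simp only [Set.indicator]
    split_ifs <;> simp [hK]
  have hdiff : localIntegral f a n (f ξ)
        - (∫ u : ℝ, (Real.exp (-n * u ^ 2) : ℂ) * (1 / ((u : ℂ) + Complex.I * ξ)))
      = ∫ u : ℝ, (Real.exp (-n * u ^ 2) : ℂ) * H u := by
    rw [hloc, ← integral_sub hiKi hq]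
    refine integral_congr_ae (Filter.Eventually.of_forall fun u => ?_)
    simp only [hH]
    ring
  have hHm : AEStronglyMeasurable H := by
    refine AEStronglyMeasurable.sub ?_ ?_
    · exact (aestronglyMeasurable_indicator_iff measurableSet_Icc).2
        (hKc.aestronglyMeasurable measurableSet_Icc)
    · exact Continuous.aestronglyMeasurable
        (continuous_const.div (by fun_prop) (add_I_mul_ne_zero hre))
  have hbound : ∀ u : ℝ, ‖H u - ∑ k ∈ Finset.range (2 * r),
      (Complex.I * taylorCoeff (regKernel f ξ) k) * (Complex.I * u) ^ k‖ ≤ C * u ^ (2 * r) := by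
    intro u
    have hu2 : u ^ (2 * r) = |u| ^ (2 * r) := by rw [pow_mul, pow_mul, sq_abs]
    have hdiffG := differentiableOn_regKernel Metric.isOpen_ball hf hinj hd hξδ
    rw [hu2]
    by_cases hu : |u| ≤ a
    · have hT := norm_sub_taylor_le hR hRδ hdiffG (hM ξ hξ) (2 * r)
        (w := Complex.I * u) (by rw [norm_I_mul_ofReal]; exact hu)
      have e : H u - ∑ k ∈ Finset.range (2 * r),
          (Complex.I * taylorCoeff (regKernel f ξ) k) * (Complex.I * u) ^ k
          = Complex.I * (regKernel f ξ (Complex.I * u) - ∑ k ∈ Finset.range (2 * r),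
            taylorCoeff (regKernel f ξ) k * (Complex.I * u) ^ k) := by
        rw [regKernel_of_ne (I_mul_ofReal_ne hre u) (hne u hu)]
        simp only [hH, hK]
        rw [Set.indicator_of_mem (Set.mem_Icc.2 (abs_le.1 hu))]
        have h1 : (u : ℂ) + Complex.I * ξ ≠ 0 := add_I_mul_ne_zero hre u
        have h2 : Complex.I * (u : ℂ) - ξ ≠ 0 := sub_ne_zero.2 (I_mul_ofReal_ne hre u)
        have h3 : 1 / ((u : ℂ) + Complex.I * ξ) = Complex.I * (1 / (Complex.I * u - ξ)) := by
          have : Complex.I * (u : ℂ) - ξ = Complex.I * (u + Complex.I * ξ) := by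
            rw [mul_add, ← mul_assoc, Complex.I_mul_I]; ring
          rw [this]
          field_simp
        rw [h3, mul_sub, mul_sub, Finset.mul_sum, mul_div_assoc]
        congr 1
        exact Finset.sum_congr rfl fun k _ => by ring
      rw [e, norm_mul, Complex.norm_I, one_mul]
      rw [norm_I_mul_ofReal] at hT
      refine hT.trans ?_
      gcongr
      rw [hC]
      linarith
    · push Not at hu
      have hind : (Set.Icc (-a) a).indicator K u = 0 :=
        Set.indicator_of_notMem (fun h => not_le.2 hu (abs_le.2 (Set.mem_Icc.1 h))) _
      have b1 : ‖1 / ((u : ℂ) + Complex.I * ξ)‖ ≤ 2 / a / a ^ (2 * r) * |u| ^ (2 * r) := by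
        -- Here |u| > a and ‖ξ‖ ≤ R/4 = a/2.
        have l1 : a / 2 ≤ ‖(u : ℂ) + Complex.I * ξ‖ := by
          have := norm_sub_le ((u : ℂ) + Complex.I * ξ) (Complex.I * ξ)
          rw [add_sub_cancel_right, Complex.norm_real, Real.norm_eq_abs, norm_mul, Complex.norm_I,
            one_mul] at this
          linarith
        rw [norm_div, norm_one]
        calc 1 / ‖(u : ℂ) + Complex.I * ξ‖ ≤ 1 / (a / 2) := by gcongr
          _ = 2 / a / a ^ (2 * r) * a ^ (2 * r) := by field_simp
          _ ≤ _ := by gcongr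
      have b2 : ‖∑ k ∈ Finset.range (2 * r),
          (Complex.I * taylorCoeff (regKernel f ξ) k) * (Complex.I * u) ^ k‖
          ≤ (∑ k ∈ Finset.range (2 * r), M / R ^ k / a ^ (2 * r - k)) * |u| ^ (2 * r) := by
        rw [Finset.sum_mul]
        refine norm_sum_le_of_le _ fun k hk => ?_
        have hk' : k ≤ 2 * r := (Finset.mem_range.1 hk).le
        rw [norm_mul, norm_mul, Complex.norm_I, one_mul, norm_pow, norm_I_mul_ofReal]
        calc _ ≤ M / R ^ k * |u| ^ k := by
              gcongr
              exact norm_taylorCoeff_le hR hRδ hdiffG (hM ξ hξ) k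
          _ = M / R ^ k / a ^ (2 * r - k) * (a ^ (2 * r - k) * |u| ^ k) := by field_simp
          _ ≤ M / R ^ k / a ^ (2 * r - k) * (|u| ^ (2 * r - k) * |u| ^ k) := by gcongr
          _ = _ := by rw [← pow_add, Nat.sub_add_cancel hk']
      simp only [hH]
      rw [hind, zero_sub]
      refine (norm_sub_le _ _).trans ?_
      rw [norm_neg]
      have h3 : 0 ≤ 2 * M / R ^ (2 * r) * |u| ^ (2 * r) := by positivity
      rw [hC, add_mul, add_mul]
      linarith
  have := norm_laplace_sub_le hHm hbound hn0
  rw [hdiff]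
  exact_mod_cast this

end SzegoCauchy

/-! ### Cauchy integrals over arcs, bounded uniformly up to the arc -/

namespace SzegoCauchy

open MeasureTheory Set

/-- A regular `C¹` arc, parametrized over `[p, q]` with derivative `γ'`. -/
structure IsRegularArc (γ γ' : ℝ → ℂ) (p q : ℝ) : Prop where
  le : p ≤ q
  hasDerivAt : ∀ t ∈ Icc p q, HasDerivAt γ (γ' t) t
  continuousOn_deriv : ContinuousOn γ' (Icc p q)
  deriv_ne_zero : ∀ t ∈ Icc p q, γ' t ≠ 0

namespace IsRegularArc

variable {γ γ' : ℝ → ℂ} {p q : ℝ}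

theorem continuousOn (hγ : IsRegularArc γ γ' p q) : ContinuousOn γ (Icc p q) :=
  fun t ht => (hγ.hasDerivAt t ht).continuousAt.continuousWithinAt

theorem mono (hγ : IsRegularArc γ γ' p q) {p' q' : ℝ} (hp : p ≤ p') (hq : q' ≤ q) (hpq : p' ≤ q') :
    IsRegularArc γ γ' p' q' where
  le := hpq
  hasDerivAt t ht := hγ.hasDerivAt t (Icc_subset_Icc hp hq ht)
  continuousOn_deriv := hγ.continuousOn_deriv.mono (Icc_subset_Icc hp hq)
  deriv_ne_zero t ht := hγ.deriv_ne_zero t (Icc_subset_Icc hp hq ht)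

theorem continuousOn_integrand (hγ : IsRegularArc γ γ' p q) {z : ℂ}
    (hz : ∀ t ∈ Icc p q, γ t ≠ z) : ContinuousOn (fun t => γ' t / (γ t - z)) (Icc p q) :=
  hγ.continuousOn_deriv.div (hγ.continuousOn.sub continuousOn_const)
    fun t ht => sub_ne_zero.2 (hz t ht)

theorem intervalIntegrable (hγ : IsRegularArc γ γ' p q) {z : ℂ}
    (hz : ∀ t ∈ Icc p q, γ t ≠ z) :
    IntervalIntegrable (fun t => γ' t / (γ t - z)) volume p q :=
  ContinuousOn.intervalIntegrable (by rw [uIcc_of_le hγ.le]; exact hγ.continuousOn_integrand hz)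

/-- A closed half-plane without the boundary point 0 lies in the slit plane, so log(c(γ - z)) is a
primitive and the imaginary part is a difference of two principal arguments. -/
theorem abs_im_integral_le_of_re_nonneg (hγ : IsRegularArc γ γ' p q) {z c : ℂ} (hc : c ≠ 0)
    (hz : ∀ t ∈ Icc p q, γ t ≠ z) (hre : ∀ t ∈ Icc p q, 0 ≤ (c * (γ t - z)).re) :
    |(∫ t in p..q, γ' t / (γ t - z)).im| ≤ 2 * π := by
  have hslit : ∀ t ∈ Icc p q, c * (γ t - z) ∈ Complex.slitPlane := by
    intro t ht
    have hne : c * (γ t - z) ≠ 0 := mul_ne_zero hc (sub_ne_zero.2 (hz t ht))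
    rw [Complex.mem_slitPlane_iff]
    rcases (hre t ht).lt_or_eq with h | h
    · exact Or.inl h
    · exact Or.inr fun h' => hne (Complex.ext h.symm h')
  have hder : ∀ t ∈ uIcc p q, HasDerivAt (fun t => Complex.log (c * (γ t - z)))
      (γ' t / (γ t - z)) t := by
    intro t ht
    rw [uIcc_of_le hγ.le] at ht
    have := (((hγ.hasDerivAt t ht).sub_const z).const_mul c).clog_real (hslit t ht)
    rwa [mul_div_mul_left _ _ hc] at this
  rw [intervalIntegral.integral_eq_sub_of_hasDerivAt hder (hγ.intervalIntegrable hz),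
    Complex.sub_im, Complex.log_im, Complex.log_im]
  have h1 := Complex.abs_arg_le_pi (c * (γ q - z))
  have h2 := Complex.abs_arg_le_pi (c * (γ p - z))
  linarith [abs_sub (Complex.arg (c * (γ q - z))) (Complex.arg (c * (γ p - z)))]

/-- Re(c(γ - z)) is strictly increasing, so the arc crosses the line through z at most once and
splits into at most two pieces, each in a half-plane. The bound does not involve z. -/
theorem abs_im_integral_le_of_re_pos (hγ : IsRegularArc γ γ' p q) {z c : ℂ}
    (hz : ∀ t ∈ Icc p q, γ t ≠ z) (hre : ∀ t ∈ Icc p q, 0 < (c * γ' t).re) :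
    |(∫ t in p..q, γ' t / (γ t - z)).im| ≤ 4 * π := by
  have hc : c ≠ 0 := by
    rintro rfl
    simpa using hre p (left_mem_Icc.2 hγ.le)
  have hpi := Real.pi_pos
  set v : ℝ → ℝ := fun t => (c * (γ t - z)).re with hv
  have hvd : ∀ t ∈ Icc p q, HasDerivAt v ((c * γ' t).re) t := by
    intro t ht
    exact Complex.reCLM.hasFDerivAt.comp_hasDerivAt t
      (((hγ.hasDerivAt t ht).sub_const z).const_mul c)
  have hvc : ContinuousOn v (Icc p q) := fun t ht => (hvd t ht).continuousAt.continuousWithinAt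
  have hmono : StrictMonoOn v (Icc p q) := by
    refine strictMonoOn_of_deriv_pos (convex_Icc p q) hvc fun t ht => ?_
    have ht' := interior_subset ht
    rw [(hvd t ht').deriv]
    exact hre t ht'
  have hpm : p ∈ Icc p q := left_mem_Icc.2 hγ.le
  have hqm : q ∈ Icc p q := right_mem_Icc.2 hγ.le
  by_cases h1 : 0 ≤ v p
  · have := hγ.abs_im_integral_le_of_re_nonneg hc hz fun t ht =>
      h1.trans (hmono.monotoneOn hpm ht ht.1)
    linarith
  push Not at h1
  by_cases h2 : v q ≤ 0
  · have := hγ.abs_im_integral_le_of_re_nonneg (neg_ne_zero.2 hc) hz fun t ht => by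
      have : v t ≤ 0 := (hmono.monotoneOn ht hqm ht.2).trans h2
      rw [neg_mul, Complex.neg_re]
      simpa [hv] using this
    linarith
  push Not at h2
  obtain ⟨m, hm, hm0⟩ := intermediate_value_Icc hγ.le hvc (show (0 : ℝ) ∈ Icc (v p) (v q) from
    ⟨h1.le, h2.le⟩)
  have a1 := hγ.mono le_rfl hm.2 hm.1
  have a2 := hγ.mono hm.1 le_rfl hm.2
  have s1 : Icc p m ⊆ Icc p q := Icc_subset_Icc le_rfl hm.2
  have s2 : Icc m q ⊆ Icc p q := Icc_subset_Icc hm.1 le_rfl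
  have i1 := a1.abs_im_integral_le_of_re_nonneg (neg_ne_zero.2 hc) (fun t ht => hz t (s1 ht))
    fun t ht => by
      have : v t ≤ 0 := (hmono.monotoneOn (s1 ht) hm ht.2).trans hm0.le
      rw [neg_mul, Complex.neg_re]
      simpa [hv] using this
  have i2 := a2.abs_im_integral_le_of_re_nonneg hc (fun t ht => hz t (s2 ht))
    fun t ht => hm0.ge.trans (hmono.monotoneOn hm (s2 ht) ht.1)
  rw [← intervalIntegral.integral_add_adjacent_intervals
    (a1.intervalIntegrable fun t ht => hz t (s1 ht)) (a2.intervalIntegrable fun t ht => hz t (s2 ht)),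
    Complex.add_im]
  refine (abs_add_le _ _).trans ?_
  linarith

/-- The variation of the argument of `γ - z` is bounded uniformly in `z`. -/
theorem exists_abs_im_integral_le (hγ : IsRegularArc γ γ' p q) :
    ∃ B : ℝ, 0 ≤ B ∧ ∀ z : ℂ, (∀ t ∈ Icc p q, γ t ≠ z) →
      |(∫ t in p..q, γ' t / (γ t - z)).im| ≤ B := by
  have hc' : Continuous fun t : Icc p q => γ' t := hγ.continuousOn_deriv.domRestrict
  -- The tangent at t makes an acute angle with the tangent at i. By compactness finitely many
  -- pieces each have such a fixed direction, and their number depends on the arc only, not on z.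
  set c : Icc p q → Set (Icc p q) := fun i => {t | 0 < (starRingEnd ℂ (γ' i) * γ' t).re} with hcdef
  have hopen : ∀ i, IsOpen (c i) := fun i => by
    refine isOpen_lt continuous_const ?_
    exact Complex.continuous_re.comp (continuous_const.mul hc')
  have hcov : univ ⊆ ⋃ i, c i := fun i _ => by
    refine mem_iUnion.2 ⟨i, ?_⟩
    simp only [hcdef, mem_ofPred_eq]
    rw [mul_comm, Complex.mul_conj, Complex.ofReal_re]
    exact Complex.normSq_pos.2 (hγ.deriv_ne_zero i i.2)
  obtain ⟨t, ht0, htm, ⟨N, hN⟩, htc⟩ := exists_monotone_Icc_subset_open_cover_Icc hγ.le hopen hcov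
  have hpi := Real.pi_pos
  have key : ∀ k : ℕ, ∀ z : ℂ, (∀ t ∈ Icc p q, γ t ≠ z) →
      |(∫ s in p..(t k : ℝ), γ' s / (γ s - z)).im| ≤ k * (4 * π) := by
    intro k z hz
    induction k with
    | zero => simp [ht0]
    | succ k ih =>
      have h1 : (t k : ℝ) ≤ t (k + 1) := htm k.le_succ
      have a1 := hγ.mono le_rfl (t k).2.2 (t k).2.1
      have a2 := hγ.mono (t k).2.1 (t (k + 1)).2.2 h1
      have s1 : Icc p (t k : ℝ) ⊆ Icc p q := Icc_subset_Icc le_rfl (t k).2.2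
      have s2 : Icc (t k : ℝ) (t (k + 1)) ⊆ Icc p q :=
        Icc_subset_Icc (t k).2.1 (t (k + 1)).2.2
      obtain ⟨i, hi⟩ := htc k
      have i2 := a2.abs_im_integral_le_of_re_pos (c := starRingEnd ℂ (γ' i))
        (fun t ht => hz t (s2 ht)) fun s hs => by
          have : (⟨s, s2 hs⟩ : Icc p q) ∈ Icc (t k) (t (k + 1)) := hs
          exact hi this
      rw [← intervalIntegral.integral_add_adjacent_intervals
        (a1.intervalIntegrable fun t ht => hz t (s1 ht))
        (a2.intervalIntegrable fun t ht => hz t (s2 ht)), Complex.add_im]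
      refine (abs_add_le _ _).trans ?_
      push_cast
      linarith
  refine ⟨N * (4 * π), by positivity, fun z hz => ?_⟩
  have := key N z hz
  rwa [hN N le_rfl] at this

/-- ln‖γ - z‖ is a single-valued primitive of the real part; hence only the distances from z to the
endpoints matter. -/
theorem re_integral_eq (hγ : IsRegularArc γ γ' p q) {z : ℂ} (hz : ∀ t ∈ Icc p q, γ t ≠ z) :
    (∫ t in p..q, γ' t / (γ t - z)).re = Real.log ‖γ q - z‖ - Real.log ‖γ p - z‖ := by
  have hint := hγ.intervalIntegrable hz
  have h1 : (∫ t in p..q, γ' t / (γ t - z)).re = ∫ t in p..q, (γ' t / (γ t - z)).re :=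
    (Complex.reCLM.intervalIntegral_comp_comm hint).symm
  have hder : ∀ t ∈ uIcc p q, HasDerivAt (fun t => Real.log ‖γ t - z‖)
      ((γ' t / (γ t - z)).re) t := by
    intro t ht
    rw [uIcc_of_le hγ.le] at ht
    have hne : γ t - z ≠ 0 := sub_ne_zero.2 (hz t ht)
    have hsq : ‖γ t - z‖ ^ 2 ≠ 0 := pow_ne_zero _ (norm_ne_zero_iff.2 hne)
    have h2 := (((hγ.hasDerivAt t ht).sub_const z).norm_sq.log hsq).div_const 2
    have e : (fun t => Real.log ‖γ t - z‖) = fun t => Real.log (‖γ t - z‖ ^ 2) / 2 := by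
      funext t; rw [Real.log_pow]; push_cast; ring
    rw [e]
    refine h2.congr_deriv ?_
    rw [Complex.div_re, Complex.inner, ← Complex.normSq_eq_norm_sq]
    simp only [Complex.mul_re, Complex.conj_re, Complex.conj_im]
    have : Complex.normSq (γ t - z) ≠ 0 := by rwa [Complex.normSq_eq_norm_sq]
    field_simp
    ring
  rw [h1, intervalIntegral.integral_eq_sub_of_hasDerivAt hder]
  exact ⟨hint.1.re, hint.2.re⟩

/-- The Cauchy integral over an arc of a function holomorphic and bounded near the arc is bounded
uniformly off the arc, away from its endpoints. -/
theorem exists_norm_cauchyIntegral_le (hγ : IsRegularArc γ γ' p q) {r ρ B : ℝ} (hr : 0 < r)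
    (hρ : 0 < ρ) : ∃ C : ℝ, 0 ≤ C ∧ ∀ (f : ℂ → ℂ) (M : ℝ),
      (∀ t ∈ Icc p q, DifferentiableOn ℂ f (Metric.ball (γ t) r)) →
      (∀ t ∈ Icc p q, ∀ s ∈ Metric.ball (γ t) r, ‖f s‖ ≤ M) →
      ∀ z : ℂ, ‖z‖ ≤ B → (∀ t ∈ Icc p q, γ t ≠ z) → ρ ≤ ‖γ p - z‖ → ρ ≤ ‖γ q - z‖ →
        ‖∫ t in p..q, f (γ t) / (γ t - z) * γ' t‖ ≤ C * M := by
  obtain ⟨A, hA0, hA⟩ := hγ.exists_abs_im_integral_le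
  obtain ⟨L, hL⟩ := isCompact_Icc.exists_bound_of_continuousOn hγ.continuousOn_deriv
  have hL0 : 0 ≤ L := (norm_nonneg _).trans (hL p (left_mem_Icc.2 hγ.le))
  set B' : ℝ := |B| + ‖γ p‖ + ‖γ q‖ + ρ with hB'
  have hB'ρ : ρ ≤ B' := by
    have := norm_nonneg (γ p); have := norm_nonneg (γ q); have := abs_nonneg B
    linarith
  have hlog : 0 ≤ Real.log B' - Real.log ρ := sub_nonneg.2 (Real.log_le_log hρ hB'ρ)
  have hqp : 0 ≤ q - p := sub_nonneg.2 hγ.le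
  refine ⟨8 / r * L * (q - p) + (A + (Real.log B' - Real.log ρ)), by positivity, ?_⟩
  intro f M hf hM z hzB hz hzp hzq
  have hM0 : 0 ≤ M :=
    (norm_nonneg _).trans (hM p (left_mem_Icc.2 hγ.le) _ (Metric.mem_ball_self hr))
  have hfc : ContinuousOn (fun t => f (γ t)) (Icc p q) := fun t ht =>
    ((((hf t ht).differentiableAt (Metric.ball_mem_nhds _ hr)).continuousAt).comp
      (hγ.hasDerivAt t ht).continuousAt).continuousWithinAt
  -- Far from the arc the integrand is bounded directly. Near it, z lies in a disc where f is
  -- holomorphic, so f z can be subtracted.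
  by_cases hfar : ∀ t ∈ Icc p q, r / 4 ≤ ‖γ t - z‖
  · have hb : ∀ t ∈ uIoc p q, ‖f (γ t) / (γ t - z) * γ' t‖ ≤ M / (r / 4) * L := by
      intro t ht
      rw [uIoc_of_le hγ.le] at ht
      have ht' := Ioc_subset_Icc_self ht
      rw [norm_mul, norm_div]
      gcongr
      · exact hM t ht' _ (Metric.mem_ball_self hr)
      · exact hfar t ht'
      · exact hL t ht'
    have := intervalIntegral.norm_integral_le_of_norm_le_const hb
    rw [abs_of_nonneg hqp] at this
    refine this.trans ?_
    have e : M / (r / 4) * L * (q - p) = 4 / r * L * (q - p) * M := by field_simp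
    rw [e]
    refine mul_le_mul_of_nonneg_right ?_ hM0
    have : 4 / r * L * (q - p) ≤ 8 / r * L * (q - p) := by gcongr; norm_num
    linarith
  push Not at hfar
  obtain ⟨t₀, ht₀, hzt⟩ := hfar
  have hzb : z ∈ Metric.ball (γ t₀) r := by
    rw [Metric.mem_ball, dist_comm, dist_eq_norm]; linarith
  -- At distance at least r/4 the trivial bound 2M/(r/4) suffices; below it, Cauchy's estimate
  -- bounds f' by M/(r/4) on a disc of radius r/2 containing both points.
  have hquot : ∀ t ∈ Icc p q, ‖(f (γ t) - f z) / (γ t - z)‖ ≤ 8 * M / r := by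
    intro t ht
    have hne : 0 < ‖γ t - z‖ := norm_pos_iff.2 (sub_ne_zero.2 (hz t ht))
    rw [norm_div, div_le_iff₀ hne]
    by_cases h : r / 4 ≤ ‖γ t - z‖
    · have h1 := hM t ht _ (Metric.mem_ball_self hr)
      have h2 := hM t₀ ht₀ _ hzb
      calc _ ≤ ‖f (γ t)‖ + ‖f z‖ := norm_sub_le _ _
        _ ≤ 8 * M / r * (r / 4) := by
          have : 8 * M / r * (r / 4) = 2 * M := by field_simp; ring
          linarith
        _ ≤ _ := by gcongr
    · push Not at h
      have hd : ∀ s ∈ Metric.ball (γ t₀) (r / 2), ‖deriv f s‖ ≤ M / (r / 4) := by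
        intro s hs
        have hsub : Metric.closedBall s (r / 4) ⊆ Metric.ball (γ t₀) r :=
          Metric.closedBall_subset_ball' (by rw [Metric.mem_ball] at hs; linarith)
        refine Complex.norm_deriv_le_of_forall_mem_sphere_norm_le (by positivity) ?_ fun w hw =>
          hM t₀ ht₀ w (hsub (Metric.sphere_subset_closedBall hw))
        refine DifferentiableOn.diffContOnCl ((hf t₀ ht₀).mono ?_)
        rw [closure_ball _ (by positivity)]
        exact hsub
      have hz2 : z ∈ Metric.ball (γ t₀) (r / 2) := by
        rw [Metric.mem_ball, dist_comm, dist_eq_norm]; linarith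
      have ht2 : γ t ∈ Metric.ball (γ t₀) (r / 2) := by
        rw [Metric.mem_ball]
        have := dist_triangle (γ t) z (γ t₀)
        rw [dist_eq_norm (γ t) z, dist_comm z, dist_eq_norm (γ t₀) z] at this
        linarith
      have := (convex_ball (γ t₀) (r / 2)).norm_image_sub_le_of_norm_deriv_le
        (fun s hs => (hf t₀ ht₀).differentiableAt (Metric.isOpen_ball.mem_nhds
          (Metric.ball_subset_ball (by linarith) hs))) hd hz2 ht2
      refine this.trans ?_
      gcongr ?_ * _
      rw [div_le_div_iff₀ (by positivity) hr]
      nlinarith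
  have hsplit : ∫ t in p..q, f (γ t) / (γ t - z) * γ' t =
      (∫ t in p..q, (f (γ t) - f z) / (γ t - z) * γ' t)
        + f z * ∫ t in p..q, γ' t / (γ t - z) := by
    rw [← intervalIntegral.integral_const_mul, ← intervalIntegral.integral_add]
    · refine intervalIntegral.integral_congr fun t _ => ?_
      ring
    · refine ContinuousOn.intervalIntegrable ?_
      rw [uIcc_of_le hγ.le]
      exact ((hfc.sub continuousOn_const).div (hγ.continuousOn.sub continuousOn_const)
        fun t ht => sub_ne_zero.2 (hz t ht)).mul hγ.continuousOn_deriv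
    · exact (hγ.intervalIntegrable hz).const_mul _
  have hI1 : ‖∫ t in p..q, (f (γ t) - f z) / (γ t - z) * γ' t‖ ≤ 8 * M / r * L * (q - p) := by
    have hb : ∀ t ∈ uIoc p q, ‖(f (γ t) - f z) / (γ t - z) * γ' t‖ ≤ 8 * M / r * L := by
      intro t ht
      rw [uIoc_of_le hγ.le] at ht
      have ht' := Ioc_subset_Icc_self ht
      rw [norm_mul]
      gcongr
      · exact hquot t ht'
      · exact hL t ht'
    have := intervalIntegral.norm_integral_le_of_norm_le_const hb
    rwa [abs_of_nonneg hqp] at this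
  have hI2 : ‖∫ t in p..q, γ' t / (γ t - z)‖ ≤ A + (Real.log B' - Real.log ρ) := by
    refine (Complex.norm_le_abs_re_add_abs_im _).trans ?_
    have him := hA z hz
    have hre := hγ.re_integral_eq hz
    have hB : ‖z‖ ≤ |B| := hzB.trans (le_abs_self B)
    have u1 : ‖γ p - z‖ ≤ B' := by
      have := norm_sub_le (γ p) z; have := norm_nonneg (γ q); linarith
    have u2 : ‖γ q - z‖ ≤ B' := by
      have := norm_sub_le (γ q) z; have := norm_nonneg (γ p); linarith
    have l1 := Real.log_le_log hρ hzp
    have l2 := Real.log_le_log hρ hzq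
    have l3 := Real.log_le_log (hρ.trans_le hzp) u1
    have l4 := Real.log_le_log (hρ.trans_le hzq) u2
    have : |(∫ t in p..q, γ' t / (γ t - z)).re| ≤ Real.log B' - Real.log ρ := by
      rw [hre, abs_le]; constructor <;> linarith
    linarith
  rw [hsplit]
  refine (norm_add_le _ _).trans ?_
  rw [norm_mul]
  have h2 := mul_le_mul (hM t₀ ht₀ z hzb) hI2 (norm_nonneg _) hM0
  have e : 8 * M / r * L * (q - p) = 8 / r * L * (q - p) * M := by ring
  rw [e] at hI1
  nlinarith

end IsRegularArc

end SzegoCauchy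

/-! ### Adapted charts and the geometry of admissible contours -/

namespace SzegoCauchy

open MeasureTheory Set

/-- Radii on which a normal form is used: `lam` maps the closed disc of radius `R` near `1`, and
the image of the disc of radius `R / 4` contains the disc of radius `2 ε` about `1`. -/
structure IsAdaptedChart (lam : OpenPartialHomeomorph ℂ ℂ) (δ₀ R ε : ℝ) : Prop where
  normal : IsNormalForm lam δ₀
  R_pos : 0 < R
  R_lt : R < δ₀
  ε_pos : 0 < ε
  near_one : ∀ w : ℂ, ‖w‖ ≤ R → ‖lam w - 1‖ < 1 / 2
  ball_subset : Metric.ball 1 (2 * ε) ⊆ lam '' Metric.ball 0 (R / 4)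

theorem IsNormalForm.mem_source {lam : OpenPartialHomeomorph ℂ ℂ} {δ₀ : ℝ}
    (hl : IsNormalForm lam δ₀) {w : ℂ} (hw : ‖w‖ < δ₀) : w ∈ lam.source := by
  rw [hl.source_eq, mem_ball_zero_iff]; exact hw

theorem IsNormalForm.hasDerivAt {lam : OpenPartialHomeomorph ℂ ℂ} {δ₀ : ℝ}
    (hl : IsNormalForm lam δ₀) {w : ℂ} (hw : ‖w‖ < δ₀) : HasDerivAt lam (deriv lam w) w :=
  (hl.holo.differentiableAt (lam.open_source.mem_nhds (hl.mem_source hw))).hasDerivAt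

theorem IsNormalForm.deriv_ne_zero {lam : OpenPartialHomeomorph ℂ ℂ} {δ₀ : ℝ}
    (hl : IsNormalForm lam δ₀) {w : ℂ} (hw : ‖w‖ < δ₀) : deriv lam w ≠ 0 := by
  have hs := hl.mem_source hw
  have h1 := hl.hasDerivAt hw
  have h2 := (hl.holo_symm.differentiableAt
    (lam.open_target.mem_nhds (lam.map_source hs))).hasDerivAt
  have h3 : HasDerivAt (fun x => x) (deriv lam.symm (lam w) * deriv lam w) w :=
    (h2.comp w h1).congr_of_eventuallyEq
      ((lam.eventually_left_inverse hs).mono fun x hx => hx.symm)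
  have h4 := h3.unique (hasDerivAt_id w)
  intro h0
  rw [h0, mul_zero] at h4
  exact zero_ne_one h4

theorem IsNormalForm.exists_isAdaptedChart {lam : OpenPartialHomeomorph ℂ ℂ} {δ₀ : ℝ}
    (hl : IsNormalForm lam δ₀) : ∃ R ε : ℝ, IsAdaptedChart lam δ₀ R ε := by
  have h0 : (0 : ℂ) ∈ lam.source := hl.mem_source (by simpa using hl.pos)
  have hc : ContinuousAt lam 0 := lam.continuousAt h0
  have hev : ∀ᶠ w in 𝓝 (0 : ℂ), ‖lam w - 1‖ < 1 / 2 := by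
    have : Filter.Tendsto (fun w => ‖lam w - 1‖) (𝓝 0) (𝓝 0) := by
      have := (hc.sub continuousAt_const).norm (f := fun w => lam w - 1)
      simpa [ContinuousAt, hl.map_zero] using this
    exact this.eventually (gt_mem_nhds (by norm_num))
  obtain ⟨η, hη, hηb⟩ := Metric.eventually_nhds_iff_ball.1 hev
  set R := min δ₀ η / 2 with hR
  have hm : 0 < min δ₀ η := lt_min hl.pos hη
  have hRpos : 0 < R := by positivity
  have hRδ : R < δ₀ := by have := min_le_left δ₀ η; linarith
  have hRη : R < η := by have := min_le_right δ₀ η; linarith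
  have himg : lam '' Metric.ball 0 (R / 4) ∈ 𝓝 (1 : ℂ) := by
    rw [← hl.map_zero]
    exact lam.image_mem_nhds h0 (Metric.ball_mem_nhds _ (by positivity))
  obtain ⟨ε, hε, hεs⟩ := Metric.mem_nhds_iff.1 himg
  refine ⟨R, ε / 2, hl, hRpos, hRδ, by positivity, fun w hw => hηb w ?_, ?_⟩
  · rw [mem_ball_zero_iff]; linarith
  · rwa [mul_div_cancel₀ _ two_ne_zero]

namespace IsAdaptedChart

variable {lam : OpenPartialHomeomorph ℂ ℂ} {δ₀ R ε : ℝ}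

theorem ne_zero (h : IsAdaptedChart lam δ₀ R ε) {w : ℂ} (hw : ‖w‖ ≤ R) : lam w ≠ 0 := by
  intro h0
  have := h.near_one w hw
  rw [h0] at this
  norm_num at this

theorem phi_lam (h : IsAdaptedChart lam δ₀ R ε) {w : ℂ} (hw : ‖w‖ ≤ R) : phi (lam w) = w ^ 2 :=
  h.normal.phi_eq w (by rw [mem_ball_zero_iff]; exact hw.trans_lt h.R_lt)

/-- In the chart φ is w², which is real and nonpositive exactly on the imaginary axis. -/
theorem mem_descentPath_iff (h : IsAdaptedChart lam δ₀ R ε) {w : ℂ} (hw : ‖w‖ ≤ R) :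
    lam w ∈ descentPath ↔ w.re = 0 := by
  have e1 : (w ^ 2).im = 2 * w.re * w.im := by simp [sq]; ring
  have e2 : (w ^ 2).re = w.re ^ 2 - w.im ^ 2 := by simp [sq]
  constructor
  · rintro ⟨-, h1, h2⟩
    rw [h.phi_lam hw] at h1 h2
    rw [e1] at h1
    rw [e2] at h2
    by_contra hre
    have him : w.im = 0 := by
      rcases mul_eq_zero.1 h1 with h3 | h3
      · exact absurd h3 (mul_ne_zero two_ne_zero hre)
      · exact h3
    rw [him] at h2
    have := sq_pos_of_ne_zero hre
    linarith
  · intro hre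
    refine ⟨h.ne_zero hw, ?_, ?_⟩
    · rw [h.phi_lam hw, e1, hre]; ring
    · rw [h.phi_lam hw, e2, hre]; nlinarith [sq_nonneg w.im]

theorem mem_source (h : IsAdaptedChart lam δ₀ R ε) {w : ℂ} (hw : ‖w‖ ≤ R) : w ∈ lam.source :=
  h.normal.mem_source (hw.trans_lt h.R_lt)

theorem hasDerivAt (h : IsAdaptedChart lam δ₀ R ε) {w : ℂ} (hw : ‖w‖ ≤ R) :
    HasDerivAt lam (deriv lam w) w :=
  h.normal.hasDerivAt (hw.trans_lt h.R_lt)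

theorem injOn (h : IsAdaptedChart lam δ₀ R ε) {w w' : ℂ} (hw : ‖w‖ ≤ R) (hw' : ‖w'‖ ≤ R)
    (e : lam w = lam w') : w = w' :=
  lam.injOn (h.mem_source hw) (h.mem_source hw') e

theorem exists_eq (h : IsAdaptedChart lam δ₀ R ε) {z : ℂ} (hz : z ∈ Metric.ball 1 (2 * ε)) :
    ∃ w : ℂ, ‖w‖ < R / 4 ∧ lam w = z ∧ lam.symm z = w ∧ z ∈ lam.target := by
  obtain ⟨w, hw, rfl⟩ := h.ball_subset hz
  rw [mem_ball_zero_iff] at hw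
  have hs := h.mem_source (w := w) (by linarith [h.R_pos])
  exact ⟨w, hw, rfl, lam.left_inv hs, lam.map_source hs⟩

/-- The steepest descent path in the chart. -/
theorem isRegularArc (h : IsAdaptedChart lam δ₀ R ε) {p q : ℝ} (hpq : p ≤ q) (hp : -R ≤ p)
    (hq : q ≤ R) : IsRegularArc (fun u : ℝ => lam (Complex.I * u))
      (fun u : ℝ => Complex.I * deriv lam (Complex.I * u)) p q where
  le := hpq
  hasDerivAt u hu := by
    have hw : ‖Complex.I * (u : ℂ)‖ ≤ R := by
      rw [norm_I_mul_ofReal, abs_le]; exact ⟨hp.trans hu.1, hu.2.trans hq⟩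
    have h1 : HasDerivAt (fun u : ℝ => Complex.I * (u : ℂ)) Complex.I u := by
      simpa using (Complex.ofRealCLM.hasDerivAt (x := u)).const_mul Complex.I
    have := (h.hasDerivAt hw).comp u h1
    rwa [mul_comm] at this
  continuousOn_deriv := by
    have hd : ContinuousOn (deriv lam) lam.source :=
      (h.normal.holo.deriv lam.open_source).continuousOn
    refine continuousOn_const.mul (hd.comp (by fun_prop) fun u hu => h.mem_source ?_)
    rw [norm_I_mul_ofReal, abs_le]
    exact ⟨hp.trans hu.1, hu.2.trans hq⟩
  deriv_ne_zero u hu := by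
    refine mul_ne_zero Complex.I_ne_zero (h.normal.deriv_ne_zero (lt_of_le_of_lt ?_ h.R_lt))
    rw [norm_I_mul_ofReal, abs_le]
    exact ⟨hp.trans hu.1, hu.2.trans hq⟩

end IsAdaptedChart

/-- The weight `s⁻ⁿ e^{n(s-1)}` of the contour integral. -/
noncomputable def weight (n : ℕ) (s : ℂ) : ℂ := (s ^ n)⁻¹ * Complex.exp (n * (s - 1))

theorem continuousOn_phi_re : ContinuousOn (fun s => (phi s).re) {s : ℂ | s ≠ 0} := by
  have : (fun s => (phi s).re) = fun s => s.re - 1 - Real.log ‖s‖ := funext phi_re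
  rw [this]
  refine ContinuousOn.sub (by fun_prop) (ContinuousOn.log (by fun_prop) fun s hs => ?_)
  exact norm_ne_zero_iff.2 hs

/-- A compact arc in the open valley has a compact thickening still inside it, where Re φ attains a
negative maximum. The decay on a neighbourhood, not only on the arc, is what allows z to approach
the arc. -/
theorem exists_forall_ball_phi_re_lt {γ : ℝ → ℂ} {p q : ℝ} (hpq : p ≤ q)
    (hc : ContinuousOn γ (Icc p q)) (h0 : ∀ t ∈ Icc p q, γ t ≠ 0)
    (hneg : ∀ t ∈ Icc p q, (phi (γ t)).re < 0) :
    ∃ r c : ℝ, 0 < r ∧ 0 < c ∧ ∀ t ∈ Icc p q, ∀ s ∈ Metric.ball (γ t) r,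
      s ≠ 0 ∧ (phi s).re ≤ -c := by
  have hK : IsCompact (γ '' Icc p q) := isCompact_Icc.image_of_continuousOn hc
  have hV : IsOpen {s : ℂ | s ≠ 0 ∧ (phi s).re < 0} := by
    have h1 : IsOpen {s : ℂ | s ≠ 0} := isOpen_ne
    exact continuousOn_phi_re.isOpen_inter_preimage h1 (isOpen_Iio (a := (0 : ℝ)))
  have hKV : γ '' Icc p q ⊆ {s : ℂ | s ≠ 0 ∧ (phi s).re < 0} := by
    rintro _ ⟨t, ht, rfl⟩
    exact ⟨h0 t ht, hneg t ht⟩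
  obtain ⟨r, hr, hrV⟩ := hK.exists_cthickening_subset_open hV hKV
  have hpm : p ∈ Icc p q := left_mem_Icc.2 hpq
  obtain ⟨m, hm, hmax⟩ := (hK.cthickening (r := r)).exists_isMaxOn
    ⟨γ p, Metric.self_subset_cthickening _ (mem_image_of_mem γ hpm)⟩
    (continuousOn_phi_re.mono fun s hs => (hrV hs).1)
  refine ⟨r, -(phi m).re, hr, neg_pos.2 (hrV hm).2, fun t ht s hs => ?_⟩
  have hs' : s ∈ Metric.cthickening r (γ '' Icc p q) :=
    Metric.mem_cthickening_of_dist_le s (γ t) r _ (mem_image_of_mem γ ht) (Metric.mem_ball.1 hs).le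
  refine ⟨(hrV hs').1, ?_⟩
  rw [neg_neg]
  exact hmax hs'

theorem IsRegularArc.exists_norm_weight_integral_le {γ γ' : ℝ → ℂ} {p q : ℝ}
    (hγ : IsRegularArc γ γ' p q) (h0 : ∀ t ∈ Icc p q, γ t ≠ 0)
    (hneg : ∀ t ∈ Icc p q, (phi (γ t)).re < 0) {ρ : ℝ} (hρ : 0 < ρ) (B : ℝ) :
    ∃ C c : ℝ, 0 ≤ C ∧ 0 < c ∧ ∀ (n : ℕ) (z : ℂ), ‖z‖ ≤ B → (∀ t ∈ Icc p q, γ t ≠ z) →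
      ρ ≤ ‖γ p - z‖ → ρ ≤ ‖γ q - z‖ →
      ‖∫ t in p..q, weight n (γ t) / (γ t - z) * γ' t‖ ≤ C * Real.exp (-c * n) := by
  obtain ⟨r, c, hr, hc, hb⟩ := exists_forall_ball_phi_re_lt hγ.le hγ.continuousOn h0 hneg
  obtain ⟨C, hC0, hC⟩ := hγ.exists_norm_cauchyIntegral_le hr hρ (B := B)
  refine ⟨C, c, hC0, hc, fun n z hzB hz hzp hzq => hC (weight n) _ ?_ ?_ z hzB hz hzp hzq⟩
  · intro t ht s hs
    have hs0 := (hb t ht s hs).1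
    have h1 : DifferentiableAt ℂ (fun s : ℂ => (s ^ n)⁻¹) s :=
      DifferentiableAt.inv (by fun_prop) (pow_ne_zero _ hs0)
    have h2 : DifferentiableAt ℂ (fun s : ℂ => Complex.exp (n * (s - 1))) s := by fun_prop
    exact (h1.mul h2).differentiableWithinAt
  · intro t ht s hs
    obtain ⟨hs0, hs1⟩ := hb t ht s hs
    rw [weight, norm_pow_inv_mul_exp hs0]
    refine Real.exp_le_exp.2 ?_
    have : (0 : ℝ) ≤ n := n.cast_nonneg
    nlinarith

theorem IsSmoothJordanCurve.exists_int_of_eq {γ : ℝ → ℂ} (hγ : IsSmoothJordanCurve γ) {s t : ℝ}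
    (h : γ s = γ t) : ∃ k : ℤ, s - t = k := by
  have hf : ∀ x : ℝ, γ (Int.fract x) = γ x := fun x => by
    have := hγ.periodic.sub_zsmul_eq (x := x) ⌊x⌋
    rwa [zsmul_one] at this
  have hm : ∀ x : ℝ, Int.fract x ∈ Ico (0 : ℝ) 1 := fun x =>
    ⟨Int.fract_nonneg x, Int.fract_lt_one x⟩
  have := hγ.injOn (hm s) (hm t) (by rw [hf, hf, h])
  exact Int.fract_eq_fract.1 this

theorem contourIntegral_eq_integral {γ : ℝ → ℂ} (hp : Function.Periodic γ 1) (t₀ : ℝ)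
    (f : ℂ → ℂ) : contourIntegral γ f = ∫ t in t₀..(t₀ + 1), f (γ t) * deriv γ t := by
  have hper : Function.Periodic (fun t => f (γ t) * deriv γ t) 1 := by
    intro t
    have h1 : deriv γ (t + 1) = deriv γ t := by
      rw [← deriv_comp_add_const γ 1 t]
      congr 1
      exact funext hp
    simp only [hp t, h1]
  rw [contourIntegral, hper.intervalIntegral_add_eq t₀ 0, zero_add]

theorem contourIntegral_comp_add {γ : ℝ → ℂ} (hp : Function.Periodic γ 1) (t₀ : ℝ) (f : ℂ → ℂ) :
    contourIntegral (fun t => γ (t + t₀)) f = contourIntegral γ f := by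
  have hd : ∀ t, deriv (fun t => γ (t + t₀)) t = deriv γ (t + t₀) := fun t =>
    deriv_comp_add_const γ t₀ t
  rw [contourIntegral_eq_integral hp t₀ f]
  simp only [contourIntegral, hd]
  rw [intervalIntegral.integral_comp_add_right (fun t => f (γ t) * deriv γ t) t₀, zero_add,
    add_comm 1 t₀]

theorem IsAdmissible.comp_add {γ : ℝ → ℂ} (hγ : IsAdmissible γ) (t₀ : ℝ) :
    IsAdmissible (fun t => γ (t + t₀)) ∧ range (fun t => γ (t + t₀)) = range γ := by
  have hr : range (fun t => γ (t + t₀)) = range γ :=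
    (Equiv.addRight t₀).surjective.range_comp γ
  refine ⟨⟨⟨?_, ?_, ?_, ?_⟩, ⟨?_, ?_⟩, ?_⟩, hr⟩
  · have := hγ.smoothJordan.contDiff
    fun_prop
  · intro t
    rw [deriv_comp_add_const]
    exact hγ.smoothJordan.deriv_ne_zero _
  · intro t
    have := hγ.smoothJordan.periodic (t + t₀)
    rwa [show t + t₀ + 1 = t + 1 + t₀ by ring] at this
  · intro s hs t ht h
    obtain ⟨k, hk⟩ := hγ.smoothJordan.exists_int_of_eq h
    rw [add_sub_add_right_eq_sub] at hk
    have h1 : (-1 : ℝ) < k := by rw [← hk]; linarith [hs.1, ht.2]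
    have h2 : (k : ℝ) < 1 := by rw [← hk]; linarith [hs.2, ht.1]
    have h1' : (-1 : ℤ) < k := by exact_mod_cast h1
    have h2' : k < (1 : ℤ) := by exact_mod_cast h2
    have : k = 0 := by omega
    rw [this] at hk
    push_cast at hk
    linarith
  · rw [hr]; exact hγ.winds.1
  · rw [contourIntegral_comp_add hγ.smoothJordan.periodic]
    exact hγ.winds.2
  · rw [hr]; exact hγ.near_one

/-- The point 1 lies on the descent path and in U, hence on the contour; shifting the parameter puts
it at 0 without changing range or integrals. -/
theorem IsAdmissible.exists_comp_add {γ : ℝ → ℂ} (hγ : IsAdmissible γ) :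
    ∃ γ₁ : ℝ → ℂ, IsAdmissible γ₁ ∧ range γ₁ = range γ ∧ γ₁ 0 = 1 ∧
      ∀ f, contourIntegral γ₁ f = contourIntegral γ f := by
  obtain ⟨U, -, h1U, hU, -⟩ := hγ.near_one
  have h1 : (1 : ℂ) ∈ range γ ∩ U := by
    rw [hU]
    refine ⟨⟨one_ne_zero, ?_, ?_⟩, h1U⟩ <;> simp [phi_one]
  obtain ⟨t₀, ht₀⟩ := h1.1
  exact ⟨_, (hγ.comp_add t₀).1, (hγ.comp_add t₀).2, by simpa using ht₀,
    contourIntegral_comp_add hγ.smoothJordan.periodic t₀⟩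

section Contour

variable {γ : ℝ → ℂ}

theorem IsAdmissible.ne_zero (hγ : IsAdmissible γ) (t : ℝ) : γ t ≠ 0 :=
  fun h => hγ.winds.1 ⟨t, h⟩

theorem IsAdmissible.hasDerivAt (hγ : IsAdmissible γ) (t : ℝ) : HasDerivAt γ (deriv γ t) t :=
  ((hγ.smoothJordan.contDiff.differentiable (by norm_num)) t).hasDerivAt

theorem IsAdmissible.continuous_deriv (hγ : IsAdmissible γ) : Continuous (deriv γ) :=
  hγ.smoothJordan.contDiff.continuous_deriv le_rfl

theorem IsAdmissible.isRegularArc (hγ : IsAdmissible γ) {p q : ℝ} (hpq : p ≤ q) :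
    IsRegularArc γ (deriv γ) p q where
  le := hpq
  hasDerivAt t _ := hγ.hasDerivAt t
  continuousOn_deriv := hγ.continuous_deriv.continuousOn
  deriv_ne_zero t _ := hγ.smoothJordan.deriv_ne_zero t

theorem IsAdmissible.ne_one (hγ : IsAdmissible γ) (h1 : γ 0 = 1) {t : ℝ} (ht : t ∈ Ioo (0 : ℝ) 1) :
    γ t ≠ 1 := by
  intro h
  have := hγ.smoothJordan.injOn ⟨ht.1.le, ht.2⟩ ⟨le_rfl, zero_lt_one⟩ (h.trans h1.symm)
  linarith [ht.1]

/-- Off the saddle point an admissible contour stays in the valley `Re φ < 0`. -/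
theorem IsAdmissible.phi_re_neg (hγ : IsAdmissible γ) (h1 : γ 0 = 1) {t : ℝ}
    (ht : t ∈ Ioo (0 : ℝ) 1) : (phi (γ t)).re < 0 := by
  obtain ⟨U, hUo, h1U, hU, d, hd, hdist⟩ := hγ.near_one
  have hcγ : Continuous γ := hγ.smoothJordan.contDiff.continuous
  have hcont : Continuous fun t => (phi (γ t)).re :=
    continuousOn_phi_re.comp_continuous hcγ hγ.ne_zero
  -- Inside U the contour is the descent path, which meets the level curve only at 1; outside U it
  -- has positive distance from the level curve.
  have hne : ∀ s ∈ Ioo (0 : ℝ) 1, (phi (γ s)).re ≠ 0 := by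
    intro s hs h0
    by_cases hsU : γ s ∈ U
    · have : γ s ∈ descentPath ∩ U := hU ▸ ⟨mem_range_self s, hsU⟩
      exact hγ.ne_one h1 hs (eq_one_of_mem_descentPath_of_re_eq_zero this.1 h0)
    · have := hdist (γ s) ⟨mem_range_self s, hsU⟩ (γ s) ⟨hγ.ne_zero s, h0⟩
      rw [dist_self] at this
      linarith
  have hev : ∀ᶠ s in 𝓝[>] (0 : ℝ), γ s ∈ U :=
    (hcγ.tendsto 0).mono_left nhdsWithin_le_nhds (hUo.mem_nhds (h1 ▸ h1U))
  obtain ⟨s, hs⟩ := (hev.and (Ioo_mem_nhdsGT (zero_lt_one (α := ℝ)))).exists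
  have hsneg : (phi (γ s)).re < 0 := by
    have : γ s ∈ descentPath ∩ U := hU ▸ ⟨mem_range_self s, hs.1⟩
    exact lt_of_le_of_ne this.1.2.2 (hne s hs.2)
  -- Just after 0 the contour is on the descent path, so Re φ is negative there; a change of sign
  -- would force a zero.
  by_contra hpos
  push Not at hpos
  have hsub : uIcc s t ⊆ Ioo (0 : ℝ) 1 := by
    rw [uIcc]
    exact Icc_subset_Ioo (lt_min hs.2.1 ht.1) (max_lt hs.2.2 ht.2)
  obtain ⟨m, hm, hm0⟩ := intermediate_value_uIcc (hcont.continuousOn (s := uIcc s t))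
    (show (0 : ℝ) ∈ uIcc (phi (γ s)).re (phi (γ t)).re by
      rw [mem_uIcc]; exact Or.inl ⟨hsneg.le, hpos⟩)
  exact hne m (hsub hm) hm0

/-- The winding number fixes the direction in which an admissible contour passes through `1`. -/
theorem IsAdmissible.not_clockwise (hγ : IsAdmissible γ) (h1 : γ 0 = 1)
    (hev : ∀ᶠ s in 𝓝[>] (0 : ℝ), (γ s).im < 0 ∧ 0 < (γ (-s)).im) : False := by
  have hcont : Continuous fun t => (γ t)⁻¹ * deriv γ t :=
    (hγ.smoothJordan.contDiff.continuous.inv₀ hγ.ne_zero).mul hγ.continuous_deriv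
  have hint : ∀ a b : ℝ, IntervalIntegrable (fun t => (γ t)⁻¹ * deriv γ t) volume a b :=
    fun a b => hcont.intervalIntegrable a b
  have hwind : ∫ t in (0 : ℝ)..1, (γ t)⁻¹ * deriv γ t = 2 * π * Complex.I := by
    have := hγ.winds.2
    have hne : (2 * π * Complex.I : ℂ) ≠ 0 := Complex.two_pi_I_ne_zero
    rw [contourIntegral, inv_mul_eq_one₀ hne] at this
    exact this.symm
  -- Re φ ≥ 0 on the positive axis, so away from 1 the contour avoids it and log(-γ) is a primitive
  -- of γ'/γ over the open period.
  have hslit : ∀ t ∈ Ioo (0 : ℝ) 1, -γ t ∈ Complex.slitPlane := by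
    intro t ht
    have hneg := hγ.phi_re_neg h1 ht
    by_contra hs
    rw [Complex.mem_slitPlane_iff, not_or, not_lt, not_not, Complex.neg_re, Complex.neg_im,
      neg_eq_zero] at hs
    have e : γ t = ((γ t).re : ℂ) := Complex.ext rfl (by simp [hs.2])
    have hpos : 0 < (γ t).re := by
      refine lt_of_le_of_ne (by linarith [hs.1]) fun h => hγ.ne_zero t ?_
      rw [e, ← h]; simp
    have := phi_re_nonneg_of_pos hpos
    rw [← e] at this
    linarith
  have hlim : Filter.Tendsto (fun s : ℝ => (∫ t in s..(1 - s), (γ t)⁻¹ * deriv γ t).im)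
      (𝓝[>] 0) (𝓝 (2 * π)) := by
    have hprim : Continuous fun x : ℝ => ∫ t in (0 : ℝ)..x, (γ t)⁻¹ * deriv γ t :=
      intervalIntegral.continuous_primitive hint 0
    have h2 : Continuous fun s : ℝ => ((∫ t in (0 : ℝ)..(1 - s), (γ t)⁻¹ * deriv γ t)
        - ∫ t in (0 : ℝ)..s, (γ t)⁻¹ * deriv γ t).im :=
      Complex.continuous_im.comp ((hprim.comp (by fun_prop)).sub hprim)
    have h3 := (h2.tendsto 0).mono_left (nhdsWithin_le_nhds (s := Ioi 0))
    simp only [sub_zero, intervalIntegral.integral_same, hwind] at h3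
    have e : (2 * π * Complex.I : ℂ).im = 2 * π := by simp
    rw [e] at h3
    refine h3.congr fun s => ?_
    rw [intervalIntegral.integral_interval_sub_left (hint _ _) (hint _ _)]
  -- If γ left 1 downwards and returned from above, arg(-γ) would start nonnegative and end
  -- negative, which contradicts the limit 2π.
  have hle : ∀ᶠ s in 𝓝[>] (0 : ℝ), (∫ t in s..(1 - s), (γ t)⁻¹ * deriv γ t).im ≤ 0 := by
    filter_upwards [hev, Ioo_mem_nhdsGT (show (0 : ℝ) < 1 / 2 by norm_num)] with s hs hs2
    have hle : s ≤ 1 - s := by linarith [hs2.2]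
    have hder : ∀ t ∈ uIcc s (1 - s), HasDerivAt (fun t => Complex.log (-γ t))
        ((γ t)⁻¹ * deriv γ t) t := by
      intro t ht
      rw [uIcc_of_le hle] at ht
      have := (hγ.hasDerivAt t).neg.clog_real (hslit t ⟨by linarith [hs2.1, ht.1],
        by linarith [hs2.1, ht.2]⟩)
      refine this.congr_deriv ?_
      rw [Pi.neg_apply, neg_div_neg_eq, div_eq_inv_mul]
    rw [intervalIntegral.integral_eq_sub_of_hasDerivAt hder (hint _ _), Complex.sub_im,
      Complex.log_im, Complex.log_im]
    have hper : γ (1 - s) = γ (-s) := by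
      have := hγ.smoothJordan.periodic (-s)
      rw [← this]; congr 1; ring
    have a1 : Complex.arg (-γ (1 - s)) < 0 := by
      rw [Complex.arg_neg_iff, hper, Complex.neg_im]; linarith [hs.2]
    have a2 : 0 ≤ Complex.arg (-γ s) := by
      rw [Complex.arg_nonneg_iff, Complex.neg_im]; linarith [hs.1]
    linarith
  have := le_of_tendsto hlim hle
  linarith [Real.pi_pos]

end Contour

end SzegoCauchy

/-! ### Reduction of the contour integral to the local integral -/

namespace SzegoCauchy

open MeasureTheory Set

variable {γ : ℝ → ℂ} {lam : OpenPartialHomeomorph ℂ ℂ} {δ₀ R ε : ℝ}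

/-- The derivative of Im λ(ix) at 0 is Im(iλ'(0)) = √2 > 0. -/
theorem IsAdaptedChart.eventually_im_sign (h : IsAdaptedChart lam δ₀ R ε) :
    ∀ᶠ x : ℝ in 𝓝 0, (x < 0 → (lam (Complex.I * x)).im < 0) ∧
      (0 < x → 0 < (lam (Complex.I * x)).im) := by
  have hd := ((h.isRegularArc (p := -R) (q := R) (by linarith [h.R_pos]) le_rfl le_rfl).hasDerivAt 0
    ⟨by linarith [h.R_pos], h.R_pos.le⟩)
  have hv : HasDerivAt (fun x : ℝ => (lam (Complex.I * x)).im) (√2) 0 := by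
    refine (Complex.imCLM.hasFDerivAt.comp_hasDerivAt (0 : ℝ) hd).congr_deriv ?_
    simp [h.normal.deriv_zero]
  have hs := hasDerivAt_iff_tendsto_slope.1 hv
  have hpos := hs.eventually (lt_mem_nhds (show (0 : ℝ) < √2 by positivity))
  rw [eventually_nhdsWithin_iff] at hpos
  filter_upwards [hpos] with x hx
  have h0 : (lam (Complex.I * (0 : ℝ))).im = 0 := by simp [h.normal.map_zero]
  have key : x ≠ 0 → 0 < (lam (Complex.I * x)).im / x := fun hne => by
    have := hx hne
    rwa [slope_def_field, h0, sub_zero, sub_zero] at this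
  constructor
  · intro hx0
    have := key hx0.ne
    rcases div_pos_iff.1 this with h2 | h2
    · linarith
    · exact h2.1
  · intro hx0
    have := key hx0.ne'
    rcases div_pos_iff.1 this with h2 | h2
    · exact h2.1
    · linarith

/-- Near `1` an admissible contour runs along the steepest descent path, upwards. -/
theorem IsAdmissible.exists_local_coordinate (hγ : IsAdmissible γ) (h1 : γ 0 = 1)
    (h : IsAdaptedChart lam δ₀ R ε) :
    ∃ (τ : ℝ) (u u' : ℝ → ℝ), 0 < τ ∧ τ < 1 / 2 ∧
      (∀ t ∈ Icc (-τ) τ, HasDerivAt u (u' t) t ∧ γ t = lam (Complex.I * u t) ∧ |u t| < R / 2 ∧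
        deriv γ t = u' t * (Complex.I * deriv lam (Complex.I * u t))) ∧
      ContinuousOn u' (Icc (-τ) τ) ∧ u 0 = 0 ∧ u (-τ) < 0 ∧ 0 < u τ := by
  obtain ⟨U, hUo, h1U, hU, -⟩ := hγ.near_one
  have hRpos := h.R_pos
  have hcγ : Continuous γ := hγ.smoothJordan.contDiff.continuous
  have h0s : (0 : ℂ) ∈ lam.source := h.mem_source (by simpa using hRpos.le)
  have himg : lam '' Metric.ball 0 (R / 2) ∈ 𝓝 (1 : ℂ) := by
    rw [← h.normal.map_zero]
    exact lam.image_mem_nhds h0s (Metric.ball_mem_nhds _ (by positivity))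
  have hev : ∀ᶠ t in 𝓝 (0 : ℝ), γ t ∈ U ∩ lam '' Metric.ball 0 (R / 2) :=
    (hcγ.tendsto 0) (h1 ▸ Filter.inter_mem (hUo.mem_nhds h1U) himg)
  obtain ⟨η, hη, hηb⟩ := Metric.eventually_nhds_iff_ball.1 hev
  -- Near 1 the contour lies on the descent path, so λ⁻¹(γ t) is purely imaginary and equals i u(t).
  set u : ℝ → ℝ := fun t => (lam.symm (γ t)).im with hu
  set u' : ℝ → ℝ := fun t => (deriv lam.symm (γ t) * deriv γ t).im with hu'
  have hmain : ∀ t ∈ Metric.ball (0 : ℝ) η, γ t = lam (Complex.I * u t) ∧ |u t| < R / 2 ∧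
      γ t ∈ lam.target := by
    intro t ht
    obtain ⟨htU, w, hw, hwt⟩ := hηb t ht
    rw [mem_ball_zero_iff] at hw
    have hwR : ‖w‖ ≤ R := by linarith
    have hsymm : lam.symm (γ t) = w := by rw [← hwt]; exact lam.left_inv (h.mem_source hwR)
    have hdp : γ t ∈ descentPath ∩ U := hU ▸ ⟨mem_range_self t, htU⟩
    have hre : w.re = 0 := (h.mem_descentPath_iff hwR).1 (hwt ▸ hdp.1)
    have hwu : w = Complex.I * (u t : ℂ) := by
      simp only [hu, hsymm]
      apply Complex.ext <;> simp [hre]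
    refine ⟨by rw [← hwu, hwt], ?_, hwt ▸ lam.map_source (h.mem_source hwR)⟩
    rw [← norm_I_mul_ofReal, ← hwu]; exact hw
  have hder : ∀ t ∈ Metric.ball (0 : ℝ) η, HasDerivAt u (u' t) t := by
    intro t ht
    have h2 := (h.normal.holo_symm.differentiableAt
      (lam.open_target.mem_nhds (hmain t ht).2.2)).hasDerivAt
    exact Complex.imCLM.hasFDerivAt.comp_hasDerivAt t (h2.comp t (hγ.hasDerivAt t))
  have hdγ : ∀ t ∈ Metric.ball (0 : ℝ) η,
      deriv γ t = u' t * (Complex.I * deriv lam (Complex.I * u t)) := by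
    intro t ht
    have hb := (hmain t ht).2.1
    have h3 := (h.isRegularArc (p := -R) (q := R) (by linarith) le_rfl le_rfl).hasDerivAt (u t)
      ⟨by linarith [(abs_lt.1 hb).1], by linarith [(abs_lt.1 hb).2]⟩
    have h4 := h3.scomp t (hder t ht)
    have h5 : γ =ᶠ[𝓝 t] (fun x : ℝ => lam (Complex.I * x)) ∘ u := by
      filter_upwards [Metric.isOpen_ball.mem_nhds ht] with s hs
      exact (hmain s hs).1
    rw [h5.deriv_eq, h4.deriv, Complex.real_smul]
  set τ := min η 1 / 3 with hτ
  have hτpos : 0 < τ := by have : 0 < min η 1 := lt_min hη one_pos; positivity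
  have hτη : τ < η := by have := min_le_left η 1; have : 0 < min η 1 := lt_min hη one_pos; linarith
  have hτ1 : τ < 1 / 2 := by have := min_le_right η 1; linarith
  have hsub : ∀ t ∈ Icc (-τ) τ, t ∈ Metric.ball (0 : ℝ) η := by
    intro t ht
    rw [mem_ball_zero_iff, Real.norm_eq_abs]
    exact (abs_le.2 ht).trans_lt hτη
  have hu0 : u 0 = 0 := by
    simp only [hu]
    rw [h1, ← h.normal.map_zero, lam.left_inv h0s, Complex.zero_im]
  have hinj : InjOn u (Icc (-τ) τ) := by
    intro s hs t ht hst
    have : γ s = γ t := by rw [(hmain s (hsub s hs)).1, (hmain t (hsub t ht)).1, hst]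
    obtain ⟨k, hk⟩ := hγ.smoothJordan.exists_int_of_eq this
    have k1 : (-1 : ℝ) < k := by rw [← hk]; linarith [hs.1, ht.2]
    have k2 : (k : ℝ) < 1 := by rw [← hk]; linarith [hs.2, ht.1]
    have k1' : (-1 : ℤ) < k := by exact_mod_cast k1
    have k2' : k < (1 : ℤ) := by exact_mod_cast k2
    have : k = 0 := by omega
    rw [this] at hk
    push_cast at hk
    linarith
  have huc : ContinuousOn u (Icc (-τ) τ) := fun t ht =>
    (hder t (hsub t ht)).continuousAt.continuousWithinAt
  have m0 : (0 : ℝ) ∈ Icc (-τ) τ := ⟨by linarith, hτpos.le⟩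
  have m1 : -τ ∈ Icc (-τ) τ := ⟨le_rfl, by linarith⟩
  have m2 : τ ∈ Icc (-τ) τ := ⟨by linarith, le_rfl⟩
  have hsign : u (-τ) < 0 ∧ 0 < u τ := by
    -- Being continuous and injective, u is strictly monotone; a decreasing u would pass through 1
    -- downwards, which the winding number excludes.
    rcases huc.strictMonoOn_of_injOn_Icc' (by linarith) hinj with hm | ha
    · exact ⟨hu0 ▸ hm m1 m0 (by linarith), hu0 ▸ hm m0 m2 hτpos⟩
    · exfalso
      refine hγ.not_clockwise h1 ?_
      have hut : Filter.Tendsto u (𝓝[>] 0) (𝓝 0) := by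
        have := (hder 0 (hsub 0 m0)).continuousAt.tendsto
        rw [hu0] at this
        exact this.mono_left nhdsWithin_le_nhds
      have hut' : Filter.Tendsto (fun s => u (-s)) (𝓝[>] 0) (𝓝 0) := by
        have h2 : Filter.Tendsto (fun s : ℝ => -s) (𝓝[>] 0) (𝓝 0) := by
          have : Filter.Tendsto (fun s : ℝ => -s) (𝓝 0) (𝓝 (-0)) := continuous_neg.tendsto 0
          rw [neg_zero] at this
          exact this.mono_left nhdsWithin_le_nhds
        have := (hder 0 (hsub 0 m0)).continuousAt.tendsto
        rw [hu0] at this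
        exact this.comp h2
      filter_upwards [hut.eventually h.eventually_im_sign, hut'.eventually h.eventually_im_sign,
        Ioo_mem_nhdsGT hτpos] with s hs hs' hsτ
      have n1 : s ∈ Icc (-τ) τ := ⟨by linarith [hsτ.1], hsτ.2.le⟩
      have n2 : -s ∈ Icc (-τ) τ := ⟨by linarith [hsτ.2], by linarith [hsτ.1]⟩
      rw [(hmain s (hsub s n1)).1, (hmain (-s) (hsub _ n2)).1]
      exact ⟨hs.1 (hu0 ▸ ha m0 n1 hsτ.1), hs'.2 (hu0 ▸ ha n2 m0 (by linarith [hsτ.1]))⟩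
  refine ⟨τ, u, u', hτpos, hτ1, fun t ht => ⟨hder t (hsub t ht), (hmain t (hsub t ht)).1,
    (hmain t (hsub t ht)).2.1, hdγ t (hsub t ht)⟩, ?_, hu0, hsign⟩
  have hd : ContinuousOn (deriv lam.symm) lam.target :=
    (h.normal.holo_symm.deriv lam.open_target).continuousOn
  exact Complex.continuous_im.comp_continuousOn
    ((hd.comp hcγ.continuousOn fun t ht => (hmain t (hsub t ht)).2.2).mul
      hγ.continuous_deriv.continuousOn)

theorem IsAdaptedChart.I_mul_norm_le (h : IsAdaptedChart lam δ₀ R ε) {x : ℝ} (hx : |x| ≤ R / 2) :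
    ‖Complex.I * (x : ℂ)‖ ≤ R := by
  rw [norm_I_mul_ofReal]; linarith [h.R_pos]

theorem IsAdaptedChart.lam_I_mul_ne (h : IsAdaptedChart lam δ₀ R ε) {z : ℂ}
    (hz : z ∉ descentPath) {x : ℝ} (hx : |x| ≤ R / 2) : lam (Complex.I * x) ≠ z := by
  rintro rfl
  exact hz ((h.mem_descentPath_iff (h.I_mul_norm_le hx)).2 (by simp))

theorem IsAdaptedChart.weight_lam (h : IsAdaptedChart lam δ₀ R ε) {x : ℝ} (hx : |x| ≤ R / 2)
    (n : ℕ) : weight n (lam (Complex.I * x)) = (Real.exp (-n * x ^ 2) : ℂ) := by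
  have hw := h.I_mul_norm_le hx
  rw [weight, ← exp_nat_mul_phi (h.ne_zero hw), h.phi_lam hw, mul_pow, Complex.I_sq]
  push_cast
  congr 1
  ring

theorem continuousOn_weight (n : ℕ) : ContinuousOn (weight n) {s : ℂ | s ≠ 0} := by
  unfold weight
  exact (ContinuousOn.inv₀ (by fun_prop) fun s hs => pow_ne_zero n hs).mul (by fun_prop)

/-- The substitution x = u(t) turns the contour over [p, q] into the local path over [-b, b], so
these parts cancel exactly, however close z is. Three arcs avoiding the saddle point remain. -/
theorem contourIntegral_sub_localIntegral_eq (hγ : IsAdmissible γ)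
    (h : IsAdaptedChart lam δ₀ R ε) {u u' : ℝ → ℝ} {p q b : ℝ} (hpq : p ≤ q)
    (hu : ∀ t ∈ Icc p q, HasDerivAt u (u' t) t ∧ γ t = lam (Complex.I * u t) ∧ |u t| < R / 2 ∧
        deriv γ t = u' t * (Complex.I * deriv lam (Complex.I * u t)))
    (hu' : ContinuousOn u' (Icc p q)) (hp : u p = -b) (hq : u q = b) (n : ℕ)
    {z : ℂ} (hz : z ∉ range γ) (hz' : z ∉ descentPath) :
    contourIntegral γ (fun s => weight n s / (s - z)) - localIntegral lam (R / 2) n z =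
      (∫ t in q..(p + 1), weight n (γ t) / (γ t - z) * deriv γ t)
      - (∫ x in b..(R / 2), weight n (lam (Complex.I * x)) / (lam (Complex.I * x) - z) *
          (Complex.I * deriv lam (Complex.I * x)))
      - ∫ x in (-(R / 2))..(-b), weight n (lam (Complex.I * x)) / (lam (Complex.I * x) - z) *
          (Complex.I * deriv lam (Complex.I * x)) := by
  have hRpos := h.R_pos
  have hcγ : Continuous γ := hγ.smoothJordan.contDiff.continuous
  set g : ℝ → ℂ := fun x => weight n (lam (Complex.I * x)) / (lam (Complex.I * x) - z) *
    (Complex.I * deriv lam (Complex.I * x)) with hg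
  have harc := h.isRegularArc (p := -(R / 2)) (q := R / 2) (by linarith) (by linarith) (by linarith)
  have hgc : ContinuousOn g (Icc (-(R / 2)) (R / 2)) := by
    refine ContinuousOn.mul (ContinuousOn.div ?_ (harc.continuousOn.sub continuousOn_const) ?_)
      harc.continuousOn_deriv
    · exact (continuousOn_weight n).comp harc.continuousOn fun x hx =>
        h.ne_zero (h.I_mul_norm_le (abs_le.2 hx))
    · exact fun x hx => sub_ne_zero.2 (h.lam_I_mul_ne hz' (abs_le.2 hx))
  have hgi : ∀ x y : ℝ, |x| ≤ R / 2 → |y| ≤ R / 2 → IntervalIntegrable g volume x y := by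
    intro x y hx hy
    refine (hgc.mono ?_).intervalIntegrable
    rw [uIcc]
    exact Icc_subset_Icc (le_min (abs_le.1 hx).1 (abs_le.1 hy).1)
      (max_le (abs_le.1 hx).2 (abs_le.1 hy).2)
  have hbR : |b| ≤ R / 2 := by
    have := (hu q ⟨hpq, le_rfl⟩).2.2.1
    rw [hq] at this
    exact this.le
  have hR2 : |R / 2| ≤ R / 2 := by rw [abs_of_pos (by positivity)]
  have hloc : localIntegral lam (R / 2) n z = ∫ x in (-(R / 2))..(R / 2), g x := by
    rw [localIntegral]
    refine intervalIntegral.integral_congr fun x hx => ?_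
    rw [uIcc_of_le (by linarith)] at hx
    simp only [hg]
    rw [h.weight_lam (abs_le.2 hx)]
    ring
  have hcont : Continuous fun t => weight n (γ t) / (γ t - z) * deriv γ t := by
    refine Continuous.mul (Continuous.div ?_ (hcγ.sub continuous_const) ?_) hγ.continuous_deriv
    · exact (continuousOn_weight n).comp_continuous hcγ hγ.ne_zero
    · exact fun t => sub_ne_zero.2 fun e => hz ⟨t, e⟩
  have hinner : ∫ t in p..q, weight n (γ t) / (γ t - z) * deriv γ t = ∫ x in (-b)..b, g x := by
    have hch := intervalIntegral.integral_deriv_smul_comp' (a := p) (b := q) (f := u) (f' := u')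
      (g := g) (fun t ht => (hu t (by rwa [uIcc_of_le hpq] at ht)).1)
      (by rwa [uIcc_of_le hpq]) (hgc.mono ?_)
    · rw [hp, hq] at hch
      rw [← hch]
      refine intervalIntegral.integral_congr fun t ht => ?_
      rw [uIcc_of_le hpq] at ht
      obtain ⟨-, e1, -, e2⟩ := hu t ht
      simp only [hg, Function.comp, Complex.real_smul]
      rw [e2, e1]
      ring
    · rintro _ ⟨t, ht, rfl⟩
      rw [uIcc_of_le hpq] at ht
      exact abs_le.1 (hu t ht).2.2.1.le
  rw [contourIntegral_eq_integral hγ.smoothJordan.periodic p,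
    ← intervalIntegral.integral_add_adjacent_intervals (hcont.intervalIntegrable p q)
      (hcont.intervalIntegrable q (p + 1)), hinner, hloc,
    ← intervalIntegral.integral_add_adjacent_intervals
      (hgi (-(R / 2)) (-b) (by rwa [abs_neg]) (by rwa [abs_neg]))
      (hgi (-b) (R / 2) (by rwa [abs_neg]) hR2),
    ← intervalIntegral.integral_add_adjacent_intervals (hgi (-b) b (by rwa [abs_neg]) hbR)
      (hgi b (R / 2) hbR hR2)]
  ring

theorem exp_neg_mul_add_le {C C' c c' : ℝ} (hC : 0 ≤ C) (hC' : 0 ≤ C') (n : ℕ) :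
    C * Real.exp (-c * n) + C' * Real.exp (-c' * n) ≤ (C + C') * Real.exp (-(min c c') * n) := by
  have hn : (0 : ℝ) ≤ n := n.cast_nonneg
  have h1 : Real.exp (-c * n) ≤ Real.exp (-(min c c') * n) :=
    Real.exp_le_exp.2 (by nlinarith [min_le_left c c'])
  have h2 : Real.exp (-c' * n) ≤ Real.exp (-(min c c') * n) :=
    Real.exp_le_exp.2 (by nlinarith [min_le_right c c'])
  rw [add_mul]
  gcongr

/-- Outside a piece of the steepest descent path the contour contributes an exponentially small
amount, as long as `z` stays away from the two points where the paths are cut. -/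
theorem exists_norm_contourIntegral_sub_le_of_cut (hγ : IsAdmissible γ) (h1 : γ 0 = 1)
    (h : IsAdaptedChart lam δ₀ R ε) {u u' : ℝ → ℝ} {p q b : ℝ} (hp0 : p ∈ Ioo (-1 / 2 : ℝ) 0)
    (hq0 : q ∈ Ioo (0 : ℝ) (1 / 2))
    (hu : ∀ t ∈ Icc p q, HasDerivAt u (u' t) t ∧ γ t = lam (Complex.I * u t) ∧ |u t| < R / 2 ∧
        deriv γ t = u' t * (Complex.I * deriv lam (Complex.I * u t)))
    (hu' : ContinuousOn u' (Icc p q)) (hp : u p = -b) (hq : u q = b) (hb : 0 < b)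
    {ρ : ℝ} (hρ : 0 < ρ) :
    ∃ C c : ℝ, 0 ≤ C ∧ 0 < c ∧ ∀ (n : ℕ),
      ∀ z ∈ Metric.ball (1 : ℂ) ε \ (range γ ∪ descentPath),
      ρ ≤ ‖lam (Complex.I * b) - z‖ → ρ ≤ ‖lam (Complex.I * (-b : ℝ)) - z‖ →
      ‖contourIntegral γ (fun s => weight n s / (s - z)) - localIntegral lam (R / 2) n z‖
        ≤ C * Real.exp (-c * n) := by
  have hRpos := h.R_pos
  have hpq : p ≤ q := by linarith [hp0.2, hq0.1]
  have hbR : b < R / 2 := by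
    have := (hu q ⟨hpq, le_rfl⟩).2.2.1
    rw [hq, abs_of_pos hb] at this
    exact this
  have hqp1 : q ≤ p + 1 := by linarith [hp0.1, hq0.2]
  have hρ' : 0 < min ρ ε := lt_min hρ h.ε_pos
  have a1 := hγ.isRegularArc hqp1
  have a2 := h.isRegularArc (p := b) (q := R / 2) hbR.le (by linarith) (by linarith)
  have a3 := h.isRegularArc (p := -(R / 2)) (q := -b) (by linarith) (by linarith) (by linarith)
  have m2 : ∀ x ∈ Icc b (R / 2), |x| ≤ R / 2 := fun x hx =>
    abs_le.2 ⟨by linarith [hx.1], hx.2⟩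
  have m3 : ∀ x ∈ Icc (-(R / 2)) (-b), |x| ≤ R / 2 := fun x hx =>
    abs_le.2 ⟨hx.1, by linarith [hx.2]⟩
  have hneg : ∀ x : ℝ, |x| ≤ R / 2 → x ≠ 0 → (phi (lam (Complex.I * x))).re < 0 := by
    intro x hx hx0
    rw [h.phi_lam (h.I_mul_norm_le hx), mul_pow, Complex.I_sq, neg_one_mul, Complex.neg_re,
      ← Complex.ofReal_pow, Complex.ofReal_re]
    exact neg_neg_of_pos (sq_pos_of_ne_zero hx0)
  obtain ⟨C1, c1, hC1, hc1, b1⟩ := a1.exists_norm_weight_integral_le (fun t _ => hγ.ne_zero t)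
    (fun t ht => hγ.phi_re_neg h1 ⟨by linarith [ht.1, hq0.1], by linarith [ht.2, hp0.2]⟩) hρ'
    (1 + ε)
  obtain ⟨C2, c2, hC2, hc2, b2⟩ := a2.exists_norm_weight_integral_le
    (fun x hx => h.ne_zero (h.I_mul_norm_le (m2 x hx)))
    (fun x hx => hneg x (m2 x hx) (by linarith [hx.1] : (0 : ℝ) < x).ne') hρ' (1 + ε)
  obtain ⟨C3, c3, hC3, hc3, b3⟩ := a3.exists_norm_weight_integral_le
    (fun x hx => h.ne_zero (h.I_mul_norm_le (m3 x hx)))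
    (fun x hx => hneg x (m3 x hx) (by linarith [hx.2] : x < 0).ne) hρ' (1 + ε)
  refine ⟨C1 + C2 + C3, min (min c1 c2) c3, by positivity, lt_min (lt_min hc1 hc2) hc3, ?_⟩
  rintro n z ⟨hzb, hzn⟩ hz1 hz2
  rw [mem_union, not_or] at hzn
  obtain ⟨hzγ, hzd⟩ := hzn
  have hzB : ‖z‖ ≤ 1 + ε := by
    rw [Metric.mem_ball, dist_eq_norm] at hzb
    have := norm_add_le (z - 1) 1
    rw [sub_add_cancel, norm_one] at this
    linarith
  -- The ends ±iR/2 of the local path lie outside the disc of radius R/4, whose image contains the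
  -- 2ε-disc about 1; hence their images stay at distance at least ε from z.
  have hend : ∀ x : ℝ, |x| = R / 2 → min ρ ε ≤ ‖lam (Complex.I * x) - z‖ := by
    intro x hx
    by_contra hlt
    push Not at hlt
    have h2 : lam (Complex.I * x) ∈ Metric.ball (1 : ℂ) (2 * ε) := by
      rw [Metric.mem_ball]
      have := dist_triangle (lam (Complex.I * x)) z 1
      rw [dist_eq_norm (lam _) z] at this
      have := min_le_right ρ ε
      rw [Metric.mem_ball] at hzb
      linarith
    obtain ⟨w, hw, hwe, -⟩ := h.exists_eq h2
    have := h.injOn (by linarith) (h.I_mul_norm_le hx.le) hwe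
    rw [this, norm_I_mul_ofReal, hx] at hw
    linarith
  have hρ1 : min ρ ε ≤ ‖lam (Complex.I * b) - z‖ := (min_le_left _ _).trans hz1
  have hρ2 : min ρ ε ≤ ‖lam (Complex.I * (-b : ℝ)) - z‖ := (min_le_left _ _).trans hz2
  have eq1 : γ q = lam (Complex.I * b) := by
    rw [(hu q ⟨hpq, le_rfl⟩).2.1, hq]
  have eq2 : γ (p + 1) = lam (Complex.I * (-b : ℝ)) := by
    rw [hγ.smoothJordan.periodic p, (hu p ⟨le_rfl, hpq⟩).2.1, hp]
  have r1 := b1 n z hzB (fun t _ e => hzγ ⟨t, e⟩) (by rwa [eq1]) (by rwa [eq2])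
  have r2 := b2 n z hzB (fun x hx => h.lam_I_mul_ne hzd (m2 x hx)) hρ1
    (hend (R / 2) (abs_of_pos (by positivity)))
  have r3 := b3 n z hzB (fun x hx => h.lam_I_mul_ne hzd (m3 x hx))
    (hend (-(R / 2)) (by rw [abs_neg, abs_of_pos (by positivity)])) hρ2
  rw [contourIntegral_sub_localIntegral_eq hγ h hpq hu hu' hp hq n hzγ hzd]
  have s1 := exp_neg_mul_add_le (c := c1) (c' := c2) hC1 hC2 n
  have s2 := exp_neg_mul_add_le (c := min c1 c2) (c' := c3) (add_nonneg hC1 hC2) hC3 n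
  refine (norm_sub_le _ _).trans ((add_le_add ((norm_sub_le _ _).trans (add_le_add r1 r2)) r3).trans
    ?_)
  linarith

/-- The difference does not depend on where the path is cut, so each z may use the more favourable
of the cuts ±b₂ and ±b₂/2. The four points λ(±ib₂), λ(±ib₂/2) are distinct, so z within ρ of one of
the first pair is at least ρ away from both of the second. -/
theorem exists_norm_contourIntegral_sub_le (hγ : IsAdmissible γ)
    (h : IsAdaptedChart lam δ₀ R ε) :
    ∃ C c : ℝ, 0 ≤ C ∧ 0 < c ∧ ∀ (n : ℕ),
      ∀ z ∈ Metric.ball (1 : ℂ) ε \ (range γ ∪ descentPath),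
      ‖contourIntegral γ (fun s => weight n s / (s - z)) - localIntegral lam (R / 2) n z‖
        ≤ C * Real.exp (-c * n) := by
  obtain ⟨γ₁, hγ₁, hr, h1, hint⟩ := hγ.exists_comp_add
  simp only [← hr, ← hint]
  obtain ⟨τ, u, u', hτ, hτ2, hu, hu', hu0, hum, hup⟩ := hγ₁.exists_local_coordinate h1 h
  have huc : ContinuousOn u (Icc (-τ) τ) := fun t ht => (hu t ht).1.continuousAt.continuousWithinAt
  set b₂ := min (u τ) (-u (-τ)) with hb₂
  have hb₂pos : 0 < b₂ := lt_min hup (by linarith)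
  have hb₂R : b₂ < R / 2 := by
    have := (hu τ ⟨by linarith, le_rfl⟩).2.2.1
    rw [abs_of_pos hup] at this
    exact (min_le_left _ _).trans_lt this
  have cut : ∀ b : ℝ, 0 < b → b ≤ b₂ → ∀ ρ : ℝ, 0 < ρ → ∃ C c : ℝ, 0 ≤ C ∧ 0 < c ∧ ∀ (n : ℕ),
      ∀ z ∈ Metric.ball (1 : ℂ) ε \ (range γ₁ ∪ descentPath),
      ρ ≤ ‖lam (Complex.I * b) - z‖ → ρ ≤ ‖lam (Complex.I * (-b : ℝ)) - z‖ →
      ‖contourIntegral γ₁ (fun s => weight n s / (s - z)) - localIntegral lam (R / 2) n z‖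
        ≤ C * Real.exp (-c * n) := by
    intro b hb hbb ρ hρ
    have i1 : b ∈ Icc (u 0) (u τ) := ⟨by rw [hu0]; exact hb.le, hbb.trans (min_le_left _ _)⟩
    have i2 : -b ∈ Icc (u (-τ)) (u 0) := by
      refine ⟨?_, by rw [hu0]; linarith⟩
      have := hbb.trans (min_le_right _ _)
      linarith
    obtain ⟨q, hq, hqb⟩ := intermediate_value_Icc hτ.le
      (huc.mono (Icc_subset_Icc (by linarith) le_rfl)) i1
    obtain ⟨p, hp, hpb⟩ := intermediate_value_Icc (by linarith : -τ ≤ 0)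
      (huc.mono (Icc_subset_Icc le_rfl hτ.le)) i2
    have hq0 : q ≠ 0 := by rintro rfl; linarith
    have hp0 : p ≠ 0 := by rintro rfl; linarith
    have hsub : Icc p q ⊆ Icc (-τ) τ := Icc_subset_Icc hp.1 hq.2
    exact exists_norm_contourIntegral_sub_le_of_cut hγ₁ h1 h
      ⟨by linarith [hp.1], lt_of_le_of_ne hp.2 hp0⟩
      ⟨lt_of_le_of_ne hq.1 hq0.symm, by linarith [hq.2]⟩ (fun t ht => hu t (hsub ht))
      (hu'.mono hsub) hpb hqb hb hρ
  have hsep : ∀ x y : ℝ, |x| = b₂ → |y| = b₂ / 2 →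
      0 < ‖lam (Complex.I * x) - lam (Complex.I * y)‖ := by
    intro x y hx hy
    rw [norm_pos_iff, sub_ne_zero]
    intro e
    have := h.injOn (h.I_mul_norm_le (by linarith)) (h.I_mul_norm_le (by linarith)) e
    have := congrArg norm this
    rw [norm_I_mul_ofReal, norm_I_mul_ofReal, hx, hy] at this
    linarith
  have e1 : |b₂| = b₂ := abs_of_pos hb₂pos
  have e2 : |-b₂| = b₂ := by rw [abs_neg, e1]
  have e3 : |b₂ / 2| = b₂ / 2 := abs_of_pos (by positivity)
  have e4 : |-(b₂ / 2)| = b₂ / 2 := by rw [abs_neg, e3]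
  obtain ⟨ρ, hρ, hρ1, hρ2, hρ3, hρ4⟩ : ∃ ρ : ℝ, 0 < ρ ∧
      2 * ρ ≤ ‖lam (Complex.I * b₂) - lam (Complex.I * (b₂ / 2 : ℝ))‖ ∧
      2 * ρ ≤ ‖lam (Complex.I * b₂) - lam (Complex.I * (-(b₂ / 2) : ℝ))‖ ∧
      2 * ρ ≤ ‖lam (Complex.I * (-b₂ : ℝ)) - lam (Complex.I * (b₂ / 2 : ℝ))‖ ∧
      2 * ρ ≤ ‖lam (Complex.I * (-b₂ : ℝ)) - lam (Complex.I * (-(b₂ / 2) : ℝ))‖ := by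
    refine ⟨min (min ‖lam (Complex.I * b₂) - lam (Complex.I * (b₂ / 2 : ℝ))‖
      ‖lam (Complex.I * b₂) - lam (Complex.I * (-(b₂ / 2) : ℝ))‖)
      (min ‖lam (Complex.I * (-b₂ : ℝ)) - lam (Complex.I * (b₂ / 2 : ℝ))‖
      ‖lam (Complex.I * (-b₂ : ℝ)) - lam (Complex.I * (-(b₂ / 2) : ℝ))‖) / 2, ?_, ?_, ?_, ?_, ?_⟩
    · exact half_pos (lt_min (lt_min (hsep _ _ e1 e3) (hsep _ _ e1 e4))
        (lt_min (hsep _ _ e2 e3) (hsep _ _ e2 e4)))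
    all_goals rw [mul_div_cancel₀ _ two_ne_zero]; simp
  obtain ⟨C1, c1, hC1, hc1, B1⟩ := cut b₂ hb₂pos le_rfl ρ hρ
  obtain ⟨C2, c2, hC2, hc2, B2⟩ := cut (b₂ / 2) (by positivity) (by linarith) ρ hρ
  refine ⟨C1 + C2, min c1 c2, by positivity, lt_min hc1 hc2, fun n z hz => ?_⟩
  have key := exp_neg_mul_add_le (c := c1) (c' := c2) hC1 hC2 n
  have p1 : 0 ≤ C1 * Real.exp (-c1 * n) := by positivity
  have p2 : 0 ≤ C2 * Real.exp (-c2 * n) := by positivity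
  have tri : ∀ x y : ℂ, 2 * ρ ≤ ‖x - y‖ → ‖x - z‖ < ρ → ρ ≤ ‖y - z‖ := by
    intro x y hxy hx
    have := norm_sub_le (x - z) (y - z)
    rw [sub_sub_sub_cancel_right] at this
    linarith
  by_cases g1 : ρ ≤ ‖lam (Complex.I * b₂) - z‖
  · by_cases g2 : ρ ≤ ‖lam (Complex.I * (-b₂ : ℝ)) - z‖
    · exact (B1 n z hz g1 g2).trans (by linarith)
    · push Not at g2
      exact (B2 n z hz (tri _ _ hρ3 g2) (tri _ _ hρ4 g2)).trans (by linarith)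
  · push Not at g1
    exact (B2 n z hz (tri _ _ hρ1 g1) (tri _ _ hρ2 g1)).trans (by linarith)

end SzegoCauchy

/-! ### The coefficient functions and the asymptotic expansion -/

namespace SzegoCauchy

open MeasureTheory Set

variable {γ : ℝ → ℂ} {lam : OpenPartialHomeomorph ℂ ℂ} {δ₀ R ε : ℝ}

/-- For ‖ξ‖ ≤ R/4 and ‖s‖ = R the two points are separated, so the unregularized formula is
continuous on a compact set. Through Cauchy's estimates this bound is the source of all uniformity
in z. -/
theorem IsAdaptedChart.exists_norm_regKernel_le (h : IsAdaptedChart lam δ₀ R ε) :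
    ∃ M : ℝ, ∀ ξ : ℂ, ‖ξ‖ ≤ R / 4 → ∀ s ∈ Metric.sphere (0 : ℂ) R, ‖regKernel lam ξ s‖ ≤ M := by
  have hRpos := h.R_pos
  have hK : IsCompact (Metric.closedBall (0 : ℂ) (R / 4) ×ˢ Metric.sphere (0 : ℂ) R) :=
    (isCompact_closedBall _ _).prod (isCompact_sphere _ _)
  have hd : ContinuousOn (deriv lam) lam.source :=
    (h.normal.holo.deriv lam.open_source).continuousOn
  have hl : ContinuousOn lam lam.source := lam.continuousOn
  have m1 : ∀ x ∈ Metric.closedBall (0 : ℂ) (R / 4) ×ˢ Metric.sphere (0 : ℂ) R, ‖x.1‖ ≤ R / 4 :=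
    fun x hx => by simpa using hx.1
  have m2 : ∀ x ∈ Metric.closedBall (0 : ℂ) (R / 4) ×ˢ Metric.sphere (0 : ℂ) R, ‖x.2‖ = R :=
    fun x hx => by simpa using hx.2
  have hne : ∀ ξ s : ℂ, ‖ξ‖ ≤ R / 4 → ‖s‖ = R → s ≠ ξ := by
    rintro ξ s h1 h2 rfl
    linarith
  have hnel : ∀ ξ s : ℂ, ‖ξ‖ ≤ R / 4 → ‖s‖ = R → lam s ≠ lam ξ := fun ξ s h1 h2 e =>
    hne ξ s h1 h2 (h.injOn h2.le (by linarith) e)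
  have hc : ContinuousOn (fun x : ℂ × ℂ => deriv lam x.2 / (lam x.2 - lam x.1) - 1 / (x.2 - x.1))
      (Metric.closedBall (0 : ℂ) (R / 4) ×ˢ Metric.sphere (0 : ℂ) R) := by
    have c1 := hd.comp continuous_snd.continuousOn
      (fun x hx => h.mem_source (m2 x hx).le)
    have c2 := hl.comp continuous_snd.continuousOn
      (fun x hx => h.mem_source (m2 x hx).le)
    have c3 := hl.comp continuous_fst.continuousOn
      (fun x hx => h.mem_source ((m1 x hx).trans (by linarith)))
    exact (c1.div (c2.sub c3) fun x hx => sub_ne_zero.2 (hnel _ _ (m1 x hx) (m2 x hx))).sub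
      (continuousOn_const.div (by fun_prop) fun x hx => sub_ne_zero.2 (hne _ _ (m1 x hx) (m2 x hx)))
  obtain ⟨M, hM⟩ := hK.exists_bound_of_continuousOn hc
  refine ⟨M, fun ξ hξ s hs => ?_⟩
  have hs' : ‖s‖ = R := by simpa using hs
  rw [regKernel_of_ne (hne ξ s hξ hs') (hnel ξ s hξ hs')]
  exact hM (ξ, s) ⟨by simpa using hξ, hs⟩

/-- The constant `(-1)ʲ Γ(j + 1/2) / √(2π)`. -/
noncomputable def gammaConst (j : ℕ) : ℂ := (-1) ^ j * ((Real.Gamma (j + 1 / 2) / √(2 * π) : ℝ) : ℂ)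

/-- The polynomial describing the principal part at `1`. -/
noncomputable def principalPoly (f : ℂ → ℂ) (j : ℕ) : Polynomial ℂ :=
  Polynomial.C (gammaConst j) * ∑ m ∈ Finset.range (2 * j + 1),
    Polynomial.C (taylorCoeff (fun s => deriv f s * (f s - f 0) ^ m) (2 * j)) *
      Polynomial.X ^ (2 * j - m)

theorem natDegree_principalPoly_le (f : ℂ → ℂ) (j : ℕ) :
    (principalPoly f j).natDegree ≤ 2 * j := by
  refine (Polynomial.natDegree_C_mul_le _ _).trans ?_
  refine Polynomial.natDegree_sum_le_of_forall_le _ _ fun m _ => ?_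
  exact (Polynomial.natDegree_C_mul_X_pow_le _ _).trans (Nat.sub_le _ _)

/-- The coefficient functions off the point `1`. -/
noncomputable def coeffAux (lam : OpenPartialHomeomorph ℂ ℂ) (j : ℕ) (z : ℂ) : ℂ :=
  gammaConst j / (lam.symm z) ^ (2 * j + 1)
    - (principalPoly lam j).eval (z - 1) / (z - 1) ^ (2 * j + 1)

/-- The coefficient functions `g_j` of the expansion. -/
noncomputable def coeffFun (lam : OpenPartialHomeomorph ℂ ℂ) (j : ℕ) : ℂ → ℂ :=
  Function.update (coeffAux lam j) 1 (Filter.limUnder (𝓝[≠] 1) (coeffAux lam j))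

theorem coeffFun_of_ne (lam : OpenPartialHomeomorph ℂ ℂ) (j : ℕ) {z : ℂ} (hz : z ≠ 1) :
    coeffFun lam j z = coeffAux lam j z := Function.update_of_ne hz _ _

theorem IsAdaptedChart.symm_one (h : IsAdaptedChart lam δ₀ R ε) : lam.symm 1 = 0 := by
  rw [← h.normal.map_zero]
  exact lam.left_inv (h.mem_source (by simpa using h.R_pos.le))

theorem IsAdaptedChart.symm_ne_zero (h : IsAdaptedChart lam δ₀ R ε) {z : ℂ}
    (hz : z ∈ Metric.ball 1 (2 * ε)) (hz1 : z ≠ 1) : lam.symm z ≠ 0 := by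
  obtain ⟨w, -, hwz, hw, -⟩ := h.exists_eq hz
  rw [hw]
  rintro rfl
  exact hz1 (by rw [← hwz, h.normal.map_zero])

/-- With ξ = λ⁻¹(z) one has λ(ξ) - λ(0) = z - 1, and `principalPoly` is the sum in
`taylorCoeff_regKernel` over the common denominator (z - 1)^(2j+1), times the constant. -/
theorem IsAdaptedChart.coeffAux_eq (h : IsAdaptedChart lam δ₀ R ε) (j : ℕ) {z : ℂ}
    (hz : z ∈ Metric.ball 1 (2 * ε)) (hz1 : z ≠ 1) :
    coeffAux lam j z = gammaConst j * taylorCoeff (regKernel lam (lam.symm z)) (2 * j) := by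
  have hne := h.symm_ne_zero hz hz1
  obtain ⟨w, hwR, hwz, hw, -⟩ := h.exists_eq hz
  have hw1 : z - 1 ≠ 0 := sub_ne_zero.2 hz1
  rw [taylorCoeff_regKernel lam.open_source h.normal.holo lam.injOn
    (h.mem_source (by simpa using h.R_pos.le))
    (h.mem_source (by rw [hw]; linarith [h.R_pos])) hne, coeffAux, principalPoly, mul_sub]
  rw [Polynomial.eval_mul, Polynomial.eval_C, Polynomial.eval_finsetSum, hw, hwz, h.normal.map_zero,
    mul_div_assoc, Finset.sum_div, mul_one_div]
  congr 2
  refine Finset.sum_congr rfl fun m hm => ?_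
  have hm' : m ≤ 2 * j := Nat.lt_succ_iff.1 (Finset.mem_range.1 hm)
  rw [Polynomial.eval_mul, Polynomial.eval_C, Polynomial.eval_pow, Polynomial.eval_X]
  have : (z - 1) ^ (2 * j + 1) = (z - 1) ^ (2 * j - m) * (z - 1) ^ (m + 1) := by
    rw [← pow_add]; congr 1; omega
  rw [this, mul_comm, mul_div_mul_left _ _ (pow_ne_zero _ hw1)]

theorem IsAdaptedChart.differentiableOn_regKernel (h : IsAdaptedChart lam δ₀ R ε) {ξ : ℂ}
    (hξ : ‖ξ‖ ≤ R) : DifferentiableOn ℂ (regKernel lam ξ) (Metric.ball 0 δ₀) := by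
  rw [← h.normal.source_eq]
  refine SzegoCauchy.differentiableOn_regKernel lam.open_source h.normal.holo lam.injOn
    (fun s hs => h.normal.deriv_ne_zero ?_) (h.mem_source hξ)
  rwa [h.normal.source_eq, mem_ball_zero_iff] at hs

/-- As Taylor coefficients of uniformly bounded kernels, these functions are bounded near 1, so
Riemann's theorem removes the singularity; no cancellation of Laurent coefficients has to be
checked. -/
theorem IsAdaptedChart.differentiableOn_coeffFun (h : IsAdaptedChart lam δ₀ R ε) (j : ℕ) :
    DifferentiableOn ℂ (coeffFun lam j) (Metric.ball 1 ε) := by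
  have hsub : Metric.ball (1 : ℂ) ε ⊆ Metric.ball 1 (2 * ε) :=
    Metric.ball_subset_ball (by linarith [h.ε_pos])
  obtain ⟨M, hM⟩ := h.exists_norm_regKernel_le
  refine Complex.differentiableOn_update_limUnder_of_bddAbove (Metric.ball_mem_nhds _ h.ε_pos) ?_ ?_
  · have hs : DifferentiableOn ℂ lam.symm (Metric.ball 1 ε \ {1}) := by
      refine h.normal.holo_symm.mono fun z hz => ?_
      obtain ⟨w, -, -, -, ht⟩ := h.exists_eq (hsub hz.1)
      exact ht
    unfold coeffAux
    refine DifferentiableOn.sub ?_ ?_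
    · exact (differentiableOn_const _).div (hs.pow _) fun z hz =>
        pow_ne_zero _ (h.symm_ne_zero (hsub hz.1) hz.2)
    · refine DifferentiableOn.div ?_ (by fun_prop) fun z hz => pow_ne_zero _ (sub_ne_zero.2 hz.2)
      exact ((principalPoly lam j).differentiable.comp
        (differentiable_id.sub_const 1)).differentiableOn
  · refine ⟨‖gammaConst j‖ * (M / R ^ (2 * j)), ?_⟩
    rintro _ ⟨z, hz, rfl⟩
    obtain ⟨w, hwR, -, hw, -⟩ := h.exists_eq (hsub hz.1)
    simp only [Function.comp]
    rw [h.coeffAux_eq j (hsub hz.1) hz.2, norm_mul, hw]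
    gcongr
    exact norm_taylorCoeff_le h.R_pos h.R_lt
      (h.differentiableOn_regKernel (by linarith [h.R_pos])) (hM w hwR.le) _

theorem exists_sqrt_mul_exp_le {c : ℝ} (hc : 0 < c) (r : ℕ) :
    ∃ K : ℝ, 0 ≤ K ∧ ∀ n : ℕ, 1 ≤ n → √(n : ℝ) * Real.exp (-c * n) ≤ K / (n : ℝ) ^ r := by
  refine ⟨(r + 1).factorial / c ^ (r + 1), by positivity, fun n hn => ?_⟩
  have hn1 : (1 : ℝ) ≤ n := by exact_mod_cast hn
  have hn0 : (0 : ℝ) < n := by linarith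
  have hs : √(n : ℝ) ≤ n := by
    rw [Real.sqrt_le_left hn0.le]; nlinarith
  have h1 := Real.pow_div_factorial_le_exp (x := c * n) (by positivity) (r + 1)
  have hf : (0 : ℝ) < (r + 1).factorial := by exact_mod_cast Nat.factorial_pos _
  rw [le_div_iff₀ (by positivity), le_div_iff₀ (by positivity)]
  rw [div_le_iff₀ hf, mul_pow] at h1
  have he : Real.exp (-c * n) * Real.exp (c * n) = 1 := by
    rw [← Real.exp_add]; simp
  calc √(n : ℝ) * Real.exp (-c * n) * (n : ℝ) ^ r * c ^ (r + 1)
      ≤ n * Real.exp (-c * n) * (n : ℝ) ^ r * c ^ (r + 1) := by gcongr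
    _ = Real.exp (-c * n) * (c ^ (r + 1) * (n : ℝ) ^ (r + 1)) := by ring
    _ ≤ Real.exp (-c * n) * (Real.exp (c * n) * (r + 1).factorial) := by gcongr
    _ = (r + 1).factorial := by rw [← mul_assoc, he, one_mul]

theorem IsAdaptedChart.exists_expansion (h : IsAdaptedChart lam δ₀ R ε) (hγ : IsAdmissible γ)
    (r : ℕ) : ∃ C : ℝ, ∀ n : ℕ, 1 ≤ n →
      ∀ z ∈ Metric.ball (1 : ℂ) ε \ (range γ ∪ descentPath), ∃ E : ℂ, ‖E‖ ≤ C / (n : ℝ) ^ r ∧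
        F γ n z = P lam n z + ((√(2 * π * n) : ℝ) : ℂ)⁻¹ *
          (∑ j ∈ Finset.range r, coeffFun lam j z / (n : ℂ) ^ j + E) := by
  have hRpos := h.R_pos
  obtain ⟨M, hM⟩ := h.exists_norm_regKernel_le
  obtain ⟨C1, c, hC1, hc, b1⟩ := exists_norm_contourIntegral_sub_le hγ h
  obtain ⟨C2, hC2, b2⟩ := exists_norm_localIntegral_sub_le hRpos h.R_lt
    (h.normal.source_eq ▸ h.normal.holo) (h.normal.source_eq ▸ lam.injOn)
    (fun s hs => h.normal.deriv_ne_zero (mem_ball_zero_iff.1 hs)) hM r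
  obtain ⟨K, hK0, hK⟩ := exists_sqrt_mul_exp_le hc r
  refine ⟨C1 * K + C2, fun n hn z hz => ?_⟩
  have hn0 : (0 : ℝ) < n := by exact_mod_cast hn
  have hsn : 0 < √(n : ℝ) := Real.sqrt_pos.2 hn0
  have hz2 : z ∈ Metric.ball (1 : ℂ) (2 * ε) :=
    Metric.ball_subset_ball (by linarith [h.ε_pos]) hz.1
  have hz1 : z ≠ 1 := by
    rintro rfl
    exact hz.2 (Or.inr ⟨one_ne_zero, by simp [phi_one], by simp [phi_one]⟩)
  obtain ⟨w, hwR, hwz, hw, -⟩ := h.exists_eq hz2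
  have hre : w.re ≠ 0 := fun h0 =>
    hz.2 (Or.inr (hwz ▸ (h.mem_descentPath_iff (by linarith)).2 h0))
  have d1 := b1 n z hz
  have d2 := b2 n hn w hwR.le hre
  rw [hwz] at d2
  have hP := P_eq_integral lam hn z
  rw [hw] at hP
  have hF : F γ n z = (2 * π * Complex.I)⁻¹ *
    contourIntegral γ (fun s => weight n s / (s - z)) := rfl
  set I0 := contourIntegral γ (fun s => weight n s / (s - z))
  set I1 := localIntegral lam (R / 2) n z
  set I2 := ∫ u : ℝ, (Real.exp (-n * u ^ 2) : ℂ) * (1 / ((u : ℂ) + Complex.I * w))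
  set S := ∑ j ∈ Finset.range r, (-1) ^ j * (Real.Gamma (j + 1 / 2) : ℂ) *
    (Complex.I * taylorCoeff (regKernel lam w) (2 * j)) / ((n : ℝ) ^ j * (√(n : ℝ) : ℝ)) with hS
  have h2pi : 0 < √(2 * π) := Real.sqrt_pos.2 (by positivity)
  have h2pi' : ((√(2 * π) : ℝ) : ℂ) ≠ 0 := by exact_mod_cast h2pi.ne'
  have hsn' : ((√(n : ℝ) : ℝ) : ℂ) ≠ 0 := by exact_mod_cast hsn.ne'
  have hsq : (2 * π : ℂ) = ((√(2 * π) : ℝ) : ℂ) * ((√(2 * π) : ℝ) : ℂ) := by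
    rw [← Complex.ofReal_mul, Real.mul_self_sqrt (by positivity)]; push_cast; ring
  have hsplit : ((√(2 * π * n) : ℝ) : ℂ) = ((√(2 * π) : ℝ) : ℂ) * ((√(n : ℝ) : ℝ) : ℂ) := by
    rw [Real.sqrt_mul (by positivity)]; push_cast; ring
  -- The i from ds = iλ'(iu) du cancels the i of 2πi, and 2π = √(2π)·√(2π) splits between the
  -- prefactor and `gammaConst`.
  have hSg : (2 * π * Complex.I)⁻¹ * S = ((√(2 * π * n) : ℝ) : ℂ)⁻¹ *
      ∑ j ∈ Finset.range r, coeffFun lam j z / (n : ℂ) ^ j := by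
    rw [hS, Finset.mul_sum, Finset.mul_sum]
    refine Finset.sum_congr rfl fun j _ => ?_
    rw [coeffFun_of_ne lam j hz1, h.coeffAux_eq j hz2 hz1, hw, gammaConst, hsplit, hsq]
    push_cast
    have hnc : (n : ℂ) ≠ 0 := by exact_mod_cast hn0.ne'
    field_simp
  refine ⟨((√(2 * π * n) : ℝ) : ℂ) * ((2 * π * Complex.I)⁻¹ * ((I0 - I1) + (I1 - I2 - S))), ?_, ?_⟩
  · rw [norm_mul, norm_mul, norm_inv, norm_mul, Complex.norm_I, mul_one, hsq, hsplit, norm_mul,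
      norm_mul, Complex.norm_real, Complex.norm_real, Real.norm_eq_abs, Real.norm_eq_abs,
      abs_of_pos h2pi, abs_of_pos hsn]
    have hone : (√(2 * π))⁻¹ ≤ 1 := by
      refine inv_le_one_of_one_le₀ ?_
      rw [Real.one_le_sqrt]
      linarith [Real.pi_gt_three]
    have e : √(2 * π) * √(n : ℝ) * ((√(2 * π) * √(2 * π))⁻¹ * ‖(I0 - I1) + (I1 - I2 - S)‖)
        = (√(2 * π))⁻¹ * (√(n : ℝ) * ‖(I0 - I1) + (I1 - I2 - S)‖) := by
      field_simp
    rw [e]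
    calc (√(2 * π))⁻¹ * (√(n : ℝ) * ‖(I0 - I1) + (I1 - I2 - S)‖)
        ≤ 1 * (√(n : ℝ) * (C1 * Real.exp (-c * n) + C2 / ((n : ℝ) ^ r * √(n : ℝ)))) := by
          gcongr
          exact (norm_add_le _ _).trans (add_le_add d1 d2)
      _ = C1 * (√(n : ℝ) * Real.exp (-c * n)) + C2 / (n : ℝ) ^ r := by
          field_simp
      _ ≤ C1 * (K / (n : ℝ) ^ r) + C2 / (n : ℝ) ^ r := by
          gcongr
          exact hK n hn
      _ = _ := by ring
  · have hne : ((√(2 * π * n) : ℝ) : ℂ) ≠ 0 := by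
      rw [hsplit]; exact mul_ne_zero h2pi' hsn'
    rw [mul_add, ← hSg, inv_mul_cancel_left₀ hne, hF, hP]
    ring

/-! ### The first two Taylor coefficients of g_0, and the theorem -/

theorem isBigO_inv_sqrt_phi {ξ : ℂ → ℂ} (hd : HasDerivAt ξ ((√2 : ℝ) : ℂ)⁻¹ 1) (h0 : ξ 1 = 0)
    (hsq : ∀ᶠ z in 𝓝 1, ξ z ^ 2 = phi z) :
    (fun z : ℂ => ((√2 : ℝ) : ℂ)⁻¹ / ξ z - 1 / (z - 1) - (1 / 3 - 1 / 12 * (z - 1)))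
      =O[𝓝[≠] 1] (fun z : ℂ => (z - 1) ^ 2) := by
  have h2 : ((√2 : ℝ) : ℂ) ≠ 0 := by simp
  have h22 : ((√2 : ℝ) : ℂ) ^ 2 = 2 := by
    rw [← Complex.ofReal_pow, Real.sq_sqrt (by norm_num)]; norm_num
  -- With w = z - 1, √2 ξ = wA and w²A² = 2φ, the quantity to bound is (1/A - p)/w. Multiplying by 1
  -- + pA, which tends to 2, leaves 1 - p²A², so only the Taylor expansion of φ is needed, not that
  -- of its root. The quadratic p satisfies p²(1 - 2w/3 + w²/2) = 1 + O(w³).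
  set A : ℂ → ℂ := fun z => ((√2 : ℝ) : ℂ) * slope ξ 1 z with hA
  set p : ℂ → ℂ := fun z => 1 + (z - 1) / 3 - (z - 1) ^ 2 / 12 with hp
  have hAlim : Filter.Tendsto A (𝓝[≠] 1) (𝓝 1) := by
    have := (hasDerivAt_iff_tendsto_slope.1 hd).const_mul ((√2 : ℝ) : ℂ)
    rwa [mul_inv_cancel₀ h2] at this
  have hplim : Filter.Tendsto p (𝓝[≠] 1) (𝓝 1) := by
    have : Continuous p := by rw [hp]; fun_prop
    have := this.tendsto 1
    simp only [hp, sub_self, zero_div, add_zero, ne_eq, OfNat.ofNat_ne_zero, not_false_eq_true,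
      zero_pow, sub_zero] at this
    exact this.mono_left nhdsWithin_le_nhds
  have hden : ∀ᶠ z in 𝓝[≠] (1 : ℂ), 1 < ‖A z * (1 + p z * A z)‖ := by
    have : Filter.Tendsto (fun z => ‖A z * (1 + p z * A z)‖) (𝓝[≠] 1) (𝓝 2) := by
      have := (hAlim.mul ((hplim.mul hAlim).const_add 1)).norm
      have e : ‖(1 : ℂ) * (1 + 1 * 1)‖ = 2 := by norm_num
      rwa [e] at this
    exact this.eventually (lt_mem_nhds (by norm_num))
  have hb : Metric.closedBall (1 : ℂ) (1 / 2) ∈ 𝓝[≠] (1 : ℂ) :=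
    mem_nhdsWithin_of_mem_nhds (Metric.closedBall_mem_nhds _ (by norm_num))
  refine Asymptotics.IsBigO.of_bound 9 ?_
  filter_upwards [hden, hb, self_mem_nhdsWithin, hsq.filter_mono nhdsWithin_le_nhds]
    with z hz hzb hz1 hzsq
  have hw2 : ‖z - 1‖ ≤ 1 / 2 := by simpa [dist_eq_norm] using hzb
  have hphi := norm_phi_sub_le hw2
  have hw : z - 1 ≠ 0 := sub_ne_zero.2 hz1
  have hξA : ((√2 : ℝ) : ℂ) * ξ z = (z - 1) * A z := by
    simp only [hA, slope_def_field, h0, sub_zero]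
    field_simp
  have hAsq : (z - 1) ^ 2 * A z ^ 2 = 2 * phi z := by
    rw [← mul_pow, ← hξA, mul_pow, h22, hzsq]
  have hA0 : A z ≠ 0 := by
    intro h
    rw [h] at hz
    norm_num at hz
  have hD0 : 1 + p z * A z ≠ 0 := by
    intro h
    rw [h] at hz
    norm_num at hz
  have hpz : p z = 1 + (z - 1) / 3 - (z - 1) ^ 2 / 12 := rfl
  have hξ : ((√2 : ℝ) : ℂ)⁻¹ / ξ z = 1 / ((z - 1) * A z) := by
    rw [← hξA, one_div, mul_inv, div_eq_mul_inv]
  generalize A z = a at *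
  generalize p z = b at *
  generalize z - 1 = w at *
  have hwpos : 0 < ‖w‖ := norm_pos_iff.2 hw
  have e1 : 1 / (w * a) - 1 / w - (1 / 3 - 1 / 12 * w)
      = (w ^ 2 * (1 - b ^ 2 * a ^ 2)) / (w ^ 3 * (a * (1 + b * a))) := by
    have : 1 / (w * a) - 1 / w - (1 / 3 - 1 / 12 * w) = (1 / a - b) / w := by
      rw [hpz]; field_simp; ring
    have hfac : 1 - b ^ 2 * a ^ 2 = (1 - b * a) * (1 + b * a) := by ring
    rw [this, hfac, div_eq_div_iff hw (mul_ne_zero (pow_ne_zero _ hw) (mul_ne_zero hA0 hD0))]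
    field_simp
  have e2 : w ^ 2 * (1 - b ^ 2 * a ^ 2) =
      -(w ^ 5 * (17 / 54 + 7 / 432 * w - 7 / 216 * w ^ 2 + w ^ 3 / 288))
        - 2 * b ^ 2 * (phi z - (w ^ 2 / 2 - w ^ 3 / 3 + w ^ 4 / 4)) := by
    have : w ^ 2 * (1 - b ^ 2 * a ^ 2) = w ^ 2 - b ^ 2 * (w ^ 2 * a ^ 2) := by ring
    rw [this, hAsq, hpz]
    ring
  have n1 : ‖17 / 54 + 7 / 432 * w - 7 / 216 * w ^ 2 + w ^ 3 / 288‖ ≤ 1 := by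
    have t1 : ‖7 / 432 * w‖ ≤ 1 / 100 := by
      rw [norm_mul]; norm_num; linarith
    have t2 : ‖7 / 216 * w ^ 2‖ ≤ 1 / 100 := by
      rw [norm_mul, norm_pow]; norm_num; nlinarith
    have t3 : ‖w ^ 3 / 288‖ ≤ 1 / 100 := by
      rw [norm_div, norm_pow]
      have : ‖w‖ ^ 3 ≤ (1 / 2) ^ 3 := by gcongr
      norm_num at this ⊢
      linarith
    have t0 : ‖(17 / 54 : ℂ)‖ ≤ 1 / 2 := by norm_num
    linarith [norm_add_le (17 / 54 + 7 / 432 * w - 7 / 216 * w ^ 2) (w ^ 3 / 288),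
      norm_sub_le (17 / 54 + 7 / 432 * w) (7 / 216 * w ^ 2), norm_add_le (17 / 54) (7 / 432 * w)]
  have n2 : ‖b‖ ≤ 2 := by
    rw [hpz]
    have t1 : ‖w / 3‖ ≤ 1 / 6 := by rw [norm_div]; norm_num; linarith
    have t2 : ‖w ^ 2 / 12‖ ≤ 1 / 6 := by rw [norm_div, norm_pow]; norm_num; nlinarith
    linarith [norm_sub_le (1 + w / 3) (w ^ 2 / 12), norm_add_le 1 (w / 3), norm_one (α := ℂ)]
  have n3 : ‖w ^ 2 * (1 - b ^ 2 * a ^ 2)‖ ≤ 9 * ‖w‖ ^ 5 := by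
    rw [e2]
    refine (norm_sub_le _ _).trans ?_
    rw [norm_neg, norm_mul, norm_mul, norm_mul, norm_pow, norm_pow, Complex.norm_ofNat]
    have : ‖w‖ ^ 5 * ‖17 / 54 + 7 / 432 * w - 7 / 216 * w ^ 2 + w ^ 3 / 288‖ ≤ ‖w‖ ^ 5 * 1 := by
      gcongr
    have : 2 * ‖b‖ ^ 2 * ‖phi z - (w ^ 2 / 2 - w ^ 3 / 3 + w ^ 4 / 4)‖ ≤ 2 * 2 ^ 2 * ‖w‖ ^ 5 := by
      gcongr
    linarith
  rw [hξ, e1, norm_div, norm_mul (w ^ 3), norm_pow, norm_pow]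
  rw [div_le_iff₀ (by positivity)]
  calc _ ≤ 9 * ‖w‖ ^ 5 := n3
    _ = 9 * ‖w‖ ^ 2 * (‖w‖ ^ 3 * 1) := by ring
    _ ≤ _ := by gcongr

theorem IsAdaptedChart.isBigO_coeffFun_zero (h : IsAdaptedChart lam δ₀ R ε) :
    (fun z : ℂ => coeffFun lam 0 z - (1 / 3 - 1 / 12 * (z - 1))) =O[𝓝 1]
      (fun z : ℂ => (z - 1) ^ 2) := by
  have hε := h.ε_pos
  have h2 : ((√2 : ℝ) : ℂ) ≠ 0 := by simp
  have h1t : (1 : ℂ) ∈ lam.target := by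
    obtain ⟨w, -, -, -, ht⟩ := h.exists_eq (Metric.mem_ball_self (by positivity : 0 < 2 * ε))
    exact ht
  have hd : HasDerivAt lam.symm ((√2 : ℝ) : ℂ)⁻¹ 1 := by
    refine lam.hasDerivAt_symm h1t h2 ?_
    rw [h.symm_one, ← h.normal.deriv_zero]
    exact h.hasDerivAt (by simpa using h.R_pos.le)
  have hsq : ∀ᶠ z in 𝓝 (1 : ℂ), lam.symm z ^ 2 = phi z := by
    filter_upwards [Metric.ball_mem_nhds (1 : ℂ) (by positivity : 0 < 2 * ε)] with z hz
    obtain ⟨w, hw, hwz, hws, -⟩ := h.exists_eq hz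
    rw [hws, ← hwz, h.phi_lam (by linarith [h.R_pos])]
  have hO := isBigO_inv_sqrt_phi hd h.symm_one hsq
  have hg0 : gammaConst 0 = ((√2 : ℝ) : ℂ)⁻¹ := by
    rw [gammaConst, pow_zero, one_mul, ← Complex.ofReal_inv]
    congr 1
    rw [Nat.cast_zero, zero_add, Real.Gamma_one_half_eq, Real.sqrt_mul (by norm_num)]
    have : √π ≠ 0 := (Real.sqrt_pos.2 Real.pi_pos).ne'
    field_simp
  -- The constant is (1/√2)·λ'(0) = 1.
  have hq0 : ∀ x, (principalPoly lam 0).eval x = 1 := by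
    intro x
    simp [principalPoly, taylorCoeff, hg0, h.normal.deriv_zero]
  have hO' : (fun z : ℂ => coeffFun lam 0 z - (1 / 3 - 1 / 12 * (z - 1))) =O[𝓝[≠] 1]
      (fun z : ℂ => (z - 1) ^ 2) := by
    refine hO.congr' ?_ Filter.EventuallyEq.rfl
    filter_upwards [self_mem_nhdsWithin] with z hz
    rw [coeffFun_of_ne lam 0 hz, coeffAux, hg0, hq0]
    simp
  -- The estimate so far is punctured; continuity of g_0 at 1 supplies the value there.
  have hval : coeffFun lam 0 1 - (1 / 3 - 1 / 12 * ((1 : ℂ) - 1)) = 0 := by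
    have hc : ContinuousAt (fun z : ℂ => coeffFun lam 0 z - (1 / 3 - 1 / 12 * (z - 1))) 1 := by
      have := (h.differentiableOn_coeffFun 0).continuousOn.continuousAt (Metric.ball_mem_nhds 1 hε)
      fun_prop
    refine tendsto_nhds_unique (hc.tendsto.mono_left nhdsWithin_le_nhds) (hO'.trans_tendsto ?_)
    have : Continuous fun z : ℂ => (z - 1) ^ 2 := by fun_prop
    have := this.tendsto 1
    simp only [sub_self, ne_eq, OfNat.ofNat_ne_zero, not_false_eq_true, zero_pow] at this
    exact this.mono_left nhdsWithin_le_nhds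
  obtain ⟨C, hC⟩ := hO'.bound
  refine Asymptotics.IsBigO.of_bound C ?_
  rw [eventually_nhdsWithin_iff] at hC
  filter_upwards [hC] with z hz
  by_cases hz1 : z = 1
  · rw [hz1, hval]; simp
  · exact hz hz1

end SzegoCauchy

theorem theorem3p1 :
    (∃ (lam : OpenPartialHomeomorph ℂ ℂ) (δ₀ : ℝ), SzegoCauchy.IsNormalForm lam δ₀) ∧
    ∀ (lam : OpenPartialHomeomorph ℂ ℂ) (δ₀ : ℝ), SzegoCauchy.IsNormalForm lam δ₀ →
      ∃ (ε : ℝ) (g : ℕ → ℂ → ℂ), 0 < ε ∧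
        Metric.ball (1 : ℂ) ε ⊆ lam.target ∧
        (∀ j, AnalyticOnNhd ℂ (g j) (Metric.ball 1 ε)) ∧
        -- the asymptotic expansion, uniform in `z`
        (∀ γ : ℝ → ℂ, SzegoCauchy.IsAdmissible γ → ∀ r : ℕ, ∃ C : ℝ,
          ∀ n : ℕ, 1 ≤ n →
            ∀ z ∈ Metric.ball (1 : ℂ) ε \ (Set.range γ ∪ SzegoCauchy.descentPath),
              ∃ E : ℂ, ‖E‖ ≤ C / (n : ℝ) ^ r ∧
                SzegoCauchy.F γ n z = SzegoCauchy.P lam n z +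
                  ((√(2 * π * n) : ℝ) : ℂ)⁻¹ *
                    (∑ j ∈ Finset.range r, g j z / (n : ℂ) ^ j + E)) ∧
        -- every `g j` is the regular part at `1` of an explicit Laurent expansion
        (∀ j : ℕ, ∃ q : Polynomial ℂ, q.natDegree ≤ 2 * j ∧
          ∀ z ∈ Metric.ball (1 : ℂ) ε, z ≠ 1 →
            g j z = (-1) ^ j * ((Real.Gamma (j + 1 / 2) / √(2 * π) : ℝ) : ℂ) /
                (lam.symm z) ^ (2 * j + 1)
              - q.eval (z - 1) / (z - 1) ^ (2 * j + 1)) ∧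
        (fun z : ℂ => g 0 z - (1 / 3 - 1 / 12 * (z - 1))) =O[𝓝 1] (fun z : ℂ => (z - 1) ^ 2) := by
  refine ⟨SzegoCauchy.exists_isNormalForm, fun lam δ₀ hl => ?_⟩
  obtain ⟨R, ε, h⟩ := hl.exists_isAdaptedChart
  refine ⟨ε, SzegoCauchy.coeffFun lam, h.ε_pos, fun z hz => ?_, fun j =>
    (h.differentiableOn_coeffFun j).analyticOnNhd Metric.isOpen_ball,
    fun γ hγ r => h.exists_expansion hγ r, fun j => ⟨SzegoCauchy.principalPoly lam j,
      SzegoCauchy.natDegree_principalPoly_le lam j, fun z _ hz1 =>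
        SzegoCauchy.coeffFun_of_ne lam j hz1⟩, h.isBigO_coeffFun_zero⟩
  obtain ⟨w, -, -, -, ht⟩ := h.exists_eq
    (Metric.ball_subset_ball (by linarith [h.ε_pos]) hz : z ∈ Metric.ball (1 : ℂ) (2 * ε))
  exact ht
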